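/- Let $\delta>0$. Let $I=[0,\infty)$ or $I=(-\infty,0]$, and let $V\in C^2(\mathbb R)$ satisfy $V(0)=V'(0)=0$ and $V''(0)>0$. Suppose that on $I$ the function $V$ is convex, monotone (non-decreasing if $I=[0,\infty)$, non-increasing if $I=(-\infty,0]$) and superquadratic (that is, $V(x)/x^2$ is strictly increasing in $|x|$ for $0\ne x\in I$), and that $$V''(x)\le V''(0)+c_1|x|^{\gamma_1}+c_2|x|^{\gamma_2}\qquad (x\in I)$$ for some $c_1,c_2\ge 1$ and $0<\gamma_1\le\gamma_2$. Let $k:\mathbb R\to\mathbb R$ be even and $m:\mathbb R\to\mathbb R$ be odd, both vanishing exactly at $0$ and non-decreasing on $[0,\infty)$, with $$\int_0^\delta \frac{\xi^2k(\xi)}{m(\xi)^{\gamma_2+2}}\,d\xi<\infty,\qquad \int_0^\delta\frac{k(\xi)}{m(\xi)}\,d\xi<\infty .$$ Let $\overline V$ be the even function that agrees with $V$ on $I$, and put $W(\eta,\xi)=V(\eta/m(\xi))k(\xi)$, $\overline W(\eta,\xi)=\overline V(\eta/m(\xi))k(\xi)$, $f=\partial_\eta W$ and $\overline f=\partial_\eta\overline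 W$. Fix $\ell\in(0,\delta)$. Let $H$ be the space of all $q\in W^{1,2}_{loc}(\mathbb R)$ (continuous representatives) with $q'\in L^2(\mathbb R)$ and $q(0)=0$. For $q\in H$ let $$T(q)=\frac12\int_{\mathbb R}q'(z)^2\,dz,\qquad U(q;z)=\int_\ell^\delta\overline W\big(q(z+\xi)-q(z),\xi\big)\,d\xi,\qquad \mathcal E^\ell(q)=\int_{\mathbb R}U(q;z)\,dz,$$ and let $\mathcal A_K=\{q\in H:\ U(q;\cdot)\in L^1(\mathbb R),\ \mathcal E^\ell(q)=K\}$. Then there is $K_0>0$ (which may depend on $\ell$) such that for every $K>K_0$ there is $q^\ell\in C^2(\mathbb R)\cap\mathcal A_K$ with $T(q^\ell)=\min_{\mathcal A_K}T$. This $q^\ell$ is monotone: non-decreasing if $I=[0,\infty)$ and non-increasing if $I=(-\infty,0]$. Moreover the minimization problem has a Lagrange multiplier $\lambda>0$ at $q^\ell$, that is, the directional derivatives at $q^\ell$ satisfy $DT(q^\ell)[\zeta]=\lambda\,D\mathcal E^\ell(q^\ell)[\zeta]$ for all $\zeta\in H$, with $D\mathcal E^\ell(q^\ell)\neq0$, and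 with $c=\lambda^{-1/2}$ the function $q^\ell$ solves $$c^2(q^\ell)''(x)=\int_\ell^\delta\Big[f\big(q^\ell(x+\xi)-q^\ell(x),\xi\big)-f\big(q^\ell(x)-q^\ell(x-\xi),\xi\big)\Big]d\xi\qquad(x\in\mathbb R),$$ as well as the same equation with $\overline f$ in place of $f$. -/

import Mathlib

open scoped ContDiff
open MeasureTheory

namespace Peridynamics

noncomputable section

/-- `V` is superquadratic on the half line `I`: the quotient `V x / x ^ 2` is strictly increasing
in `|x|` for nonzero `x` in `I`. -/
def SuperquadraticOn (V : ℝ → ℝ) (I : Set ℝ) : Prop :=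
  ∀ x ∈ I, ∀ y ∈ I, x ≠ 0 → |x| < |y| → V x / x ^ 2 < V y / y ^ 2

/-- The assumptions on the profile `V`, where `I` is the half line on which `V` is
superquadratic. -/
structure ProfileAssumptions (V : ℝ → ℝ) (I : Set ℝ) (c₁ c₂ γ₁ γ₂ : ℝ) : Prop where
  halfLine : I = Set.Ici 0 ∨ I = Set.Iic 0
  contDiff : ContDiff ℝ 2 V
  monotoneOn : I = Set.Ici 0 → MonotoneOn V I
  antitoneOn : I = Set.Iic 0 → AntitoneOn V I
  convexOn : ConvexOn ℝ I V
  superquadraticOn : SuperquadraticOn V I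
  zero : V 0 = 0
  deriv_zero : deriv V 0 = 0
  deriv2_zero_pos : 0 < iteratedDeriv 2 V 0
  one_le_c₁ : 1 ≤ c₁
  one_le_c₂ : 1 ≤ c₂
  γ₁_pos : 0 < γ₁
  γ₁_le_γ₂ : γ₁ ≤ γ₂
  growth : ∀ x ∈ I, iteratedDeriv 2 V x ≤ iteratedDeriv 2 V 0 + c₁ * |x| ^ γ₁ + c₂ * |x| ^ γ₂

/-- The assumptions on the scaling function `m` and the weight `k`, with horizon `δ`. -/
structure ScalingAssumptions (m k : ℝ → ℝ) (γ₂ δ : ℝ) : Prop where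
  k_even : ∀ ξ, k (-ξ) = k ξ
  m_odd : ∀ ξ, m (-ξ) = -m ξ
  k_eq_zero_iff : ∀ ξ, k ξ = 0 ↔ ξ = 0
  m_eq_zero_iff : ∀ ξ, m ξ = 0 ↔ ξ = 0
  k_mono : MonotoneOn k (Set.Ici 0)
  m_mono : MonotoneOn m (Set.Ici 0)
  integrable₁ : IntegrableOn (fun ξ => ξ ^ 2 * k ξ / m ξ ^ (γ₂ + 2)) (Set.Ioo 0 δ)
  integrable₂ : IntegrableOn (fun ξ => k ξ / m ξ) (Set.Ioo 0 δ)

open Classical in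
/-- The symmetrized profile: the even function that agrees with `V` on the half line `I`. -/
def symmetrized (V : ℝ → ℝ) (I : Set ℝ) (x : ℝ) : ℝ :=
  if x ∈ I then V x else V (-x)

/-- The micropotential `W(η, ξ) = V(η / m(ξ)) k(ξ)`. -/
def micropotential (V m k : ℝ → ℝ) (η ξ : ℝ) : ℝ := V (η / m ξ) * k ξ

/-- The pairwise force density `f = ∂W/∂η`. -/
def bondForce (W : ℝ → ℝ → ℝ) (η ξ : ℝ) : ℝ := deriv (fun η' => W η' ξ) η

/-- `g` is a weak derivative of `q` on `ℝ`. -/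
def IsWeakDeriv (q g : ℝ → ℝ) : Prop :=
  LocallyIntegrable q ∧ LocallyIntegrable g ∧
    ∀ φ : ℝ → ℝ, ContDiff ℝ ∞ φ → HasCompactSupport φ →
      ∫ x, q x * deriv φ x = -∫ x, g x * φ x

open Classical in
/-- The weak derivative of `q` (unique up to null sets), or `0` if there is none. -/
def weakDeriv (q : ℝ → ℝ) : ℝ → ℝ :=
  if h : ∃ g, IsWeakDeriv q g then h.choose else 0

/-- The space `H` of all `q ∈ W^{1,2}_loc(ℝ)`, given by their continuous representatives, with
`q' ∈ L²(ℝ)` and `q(0) = 0`. -/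
def energySpace : Set (ℝ → ℝ) :=
  {q | Continuous q ∧ (∃ g, IsWeakDeriv q g) ∧ MemLp (weakDeriv q) 2 volume ∧ q 0 = 0}

/-- The kinetic energy `T(q) = ½ ∫ q'(z)² dz`. -/
def kineticEnergy (q : ℝ → ℝ) : ℝ := 1 / 2 * ∫ z, weakDeriv q z ^ 2

/-- The potential energy density `U(q; z)` with bonds of length in `[ℓ, δ]`. -/
def energyDensity (W : ℝ → ℝ → ℝ) (ℓ δ : ℝ) (q : ℝ → ℝ) (z : ℝ) : ℝ :=
  ∫ ξ in ℓ..δ, W (q (z + ξ) - q z) ξ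

/-- The truncated potential energy. -/
def potentialEnergy (W : ℝ → ℝ → ℝ) (ℓ δ : ℝ) (q : ℝ → ℝ) : ℝ :=
  ∫ z, energyDensity W ℓ δ q z

/-- The admissible class: `q ∈ H` with integrable energy density and potential energy `K`. -/
def admissible (W : ℝ → ℝ → ℝ) (ℓ δ K : ℝ) : Set (ℝ → ℝ) :=
  {q | q ∈ energySpace ∧ Integrable (energyDensity W ℓ δ q) ∧ potentialEnergy W ℓ δ q = K}

/-- `μ` is a Lagrange multiplier at `q` for `T` under a constraint on `E`, with variations in `S`:
`DT(q)[ζ] = μ DE(q)[ζ]` for all `ζ ∈ S`, and `DE(q)` is not identically zero. -/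
def IsLagrangeMultiplier (T E : (ℝ → ℝ) → ℝ) (S : Set (ℝ → ℝ)) (q : ℝ → ℝ) (μ : ℝ) : Prop :=
  ∃ D : (ℝ → ℝ) → ℝ, (∃ ζ ∈ S, D ζ ≠ 0) ∧ ∀ ζ ∈ S,
    HasDerivAt (fun ε : ℝ => E (q + ε • ζ)) (D ζ) 0 ∧
    HasDerivAt (fun ε : ℝ => T (q + ε • ζ)) (μ * D ζ) 0

/-- The truncated travelling wave equation with wave speed `c` and force density `f`. -/
def SolvesTravellingWave (f : ℝ → ℝ → ℝ) (ℓ δ c : ℝ) (q : ℝ → ℝ) : Prop :=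
  ∀ x, c ^ 2 * iteratedDeriv 2 q x =
    ∫ ξ in ℓ..δ, (f (q (x + ξ) - q x) ξ - f (q x - q (x - ξ)) ξ)

end

end Peridynamics

open Peridynamics

/-!
A displacement `q` in the energy space is the primitive `prim u` of its derivative `u ∈ L²(ℝ)`, so
that `T(q) = ½ ‖u‖²`, and the potential energy is the integral of the symmetrized profile `Φ` of the
scaled strain `(q(z + ξ) - q(z)) / m(ξ)` over all bonds `(z, ξ)`, where `ξ` carries the measure
`k(ξ) dξ` on `(ℓ, δ]`. As `ℓ > 0`, the strain is a bounded operator from `L²` into `L²` and `L∞`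
of the bonds (`isStrainOperator_bondStrainL`), and the singularity of the kernel plays no role.

Minimizing the norm at energy `K` is the same as minimizing it at energy at least `K`, by scaling.
A minimizing sequence `w` is compact up to translation for two reasons, both resting on `Φ(x) / x²`
being strictly increasing in `|x|`.

* It does not vanish. If `a` is the infimum of `Φ(x) / x²` and `β` the squared norm of the strain
  operator, small strains give `E(w) ≤ (a + o(1)) β ‖w‖²`. A long interval of constant strain has
  energy larger than `a β ‖u‖²` (`exists_quadratic_lt_bondEnergy`); its energy is the threshold
  `K₀`, and beyond it small strains are ruled out, so that after a translation the weak limit has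
  positive energy (`exists_shift_weakTendsto`).
* It does not split. By the Brezis-Lieb identity (`tendsto_strainEnergy_sub`) both the energy and
  the squared norm are asymptotically additive over the weak limit and the remainder, whereas
  `E(t u) > t² E(u)` for `t > 1` makes every vector of energy strictly between `0` and `K` less
  efficient than the optimum (`eq_of_minimizing_weakTendsto`).

Replacing `u` by `|u|` does not decrease the energy, which gives a monotone minimizer. The
multiplier rule `inner_eq_of_isMin` tested with derivatives of test functions says that `u` has the
continuous weak derivative `μ F`, where `F` is the total bond force; hence `q` is of class `C²` and
solves the wave equation with `c² = 1 / μ`. On a monotone `q` all strains lie in the half line `I`,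
where `Φ` and `V` agree.
-/

namespace Peridynamics

open Filter Topology Set

/-! ### Weak derivatives on the line -/

theorem exists_tsupport_subset_Ioo {φ : ℝ → ℝ} (h : HasCompactSupport φ) :
    ∃ R, 0 < R ∧ tsupport φ ⊆ Ioo (-R) R := by
  obtain ⟨R, hR, hs⟩ := h.isCompact.isBounded.subset_ball_lt 0 0
  exact ⟨R, hR, by simpa [Real.ball_eq_Ioo] using hs⟩

theorem support_deriv_subset_Ioc {φ : ℝ → ℝ} {R : ℝ} (h : tsupport φ ⊆ Ioo (-R) R) :
    Function.support (deriv φ) ⊆ Ioc (-R) R :=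
  (support_deriv_subset.trans h).trans Ioo_subset_Ioc_self

theorem intervalIntegrable_of_locallyIntegrable {g : ℝ → ℝ} (hg : LocallyIntegrable g) (a b : ℝ) :
    IntervalIntegrable g volume a b :=
  intervalIntegrable_iff.mpr
    ((hg.integrableOn_isCompact isCompact_uIcc).mono_set uIoc_subset_uIcc)

theorem continuous_integral_zero {g : ℝ → ℝ} (hg : LocallyIntegrable g) :
    Continuous fun x => ∫ t in (0 : ℝ)..x, g t :=
  intervalIntegral.continuous_primitive (intervalIntegrable_of_locallyIntegrable hg) 0

/-- A locally integrable function is a weak derivative of its primitive. -/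
theorem isWeakDeriv_integral {g : ℝ → ℝ} (hg : LocallyIntegrable g) :
    IsWeakDeriv (fun x => ∫ t in (0 : ℝ)..x, g t) g := by
  refine ⟨(continuous_integral_zero hg).locallyIntegrable, hg, fun φ hφ hc => ?_⟩
  obtain ⟨R, hR, hs⟩ := exists_tsupport_subset_Ioo hc
  have hsupp : Function.support φ ⊆ Ioc (-R) R :=
    ((subset_tsupport φ).trans hs).trans Ioo_subset_Ioc_self
  have hz : ∀ x, x ∉ Ioo (-R) R → φ x = 0 := fun x hx => image_eq_zero_of_notMem_tsupport
    (fun h => hx (hs h))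
  rw [← intervalIntegral.integral_eq_integral_of_support_subset
      (a := -R) (b := R) (f := fun x => (∫ t in (0 : ℝ)..x, g t) * deriv φ x),
    ← intervalIntegral.integral_eq_integral_of_support_subset
      (a := -R) (b := R) (f := fun x => g x * φ x)]
  · have hF : AbsolutelyContinuousOnInterval (fun x => ∫ t in (0 : ℝ)..x, g t) (-R) R :=
      IntervalIntegrable.absolutelyContinuousOnInterval_intervalIntegral
        (intervalIntegrable_of_locallyIntegrable hg _ _) (by rw [uIcc_of_le (by linarith)]; constructor <;> linarith)
    have hφ' : AbsolutelyContinuousOnInterval φ (-R) R :=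
      ContDiffOn.absolutelyContinuousOnInterval
        ((hφ.of_le (by exact_mod_cast le_top)).contDiffOn)
    rw [hF.integral_mul_deriv_eq_deriv_mul hφ', hz R (by simp), hz (-R) (by simp)]
    simp only [mul_zero, sub_self, zero_sub, neg_inj]
    refine intervalIntegral.integral_congr_ae ?_
    filter_upwards [_root_.LocallyIntegrable.ae_hasDerivAt_integral hg] with x hx _
    rw [(hx 0).deriv]
  · exact (Function.support_mul_subset_right _ _).trans hsupp
  · exact (Function.support_mul_subset_right _ _).trans (support_deriv_subset_Ioc hs)

/-- The antiderivative of a test function of mean zero is again a test function. -/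
theorem exists_antideriv {χ : ℝ → ℝ} (hχ : ContDiff ℝ ∞ χ) (hc : HasCompactSupport χ)
    (h0 : ∫ x, χ x = 0) :
    ∃ η : ℝ → ℝ, ContDiff ℝ ∞ η ∧ HasCompactSupport η ∧ deriv η = χ := by
  obtain ⟨R, hR, hs⟩ := exists_tsupport_subset_Ioo hc
  have hz : ∀ x, x ∉ Ioo (-R) R → χ x = 0 := fun x hx => image_eq_zero_of_notMem_tsupport
    (fun h => hx (hs h))
  have hd : ∀ x, HasDerivAt (fun x => ∫ t in (-R)..x, χ t) (χ x) x := fun x =>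
    hχ.continuous.integral_hasStrictDerivAt _ _ |>.hasDerivAt
  have hderiv : deriv (fun x => ∫ t in (-R)..x, χ t) = χ := funext fun x => (hd x).deriv
  refine ⟨fun x => ∫ t in (-R)..x, χ t, ?_, ?_, hderiv⟩
  · rw [contDiff_infty_iff_deriv, hderiv]
    exact ⟨fun x => (hd x).differentiableAt, hχ⟩
  · refine HasCompactSupport.intro (isCompact_Icc (a := -R) (b := R)) fun x hx => ?_
    rcases not_and_or.mp hx with h | h
    · push Not at h
      rw [intervalIntegral.integral_symm, intervalIntegral.integral_of_le h.le,
        setIntegral_eq_zero_of_forall_eq_zero, neg_zero]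
      intro t ht
      exact hz t fun h' => by linarith [h'.1, ht.2]
    · push Not at h
      rw [intervalIntegral.integral_eq_integral_of_support_subset, h0]
      intro t ht
      by_contra hh
      exact ht (hz t fun h' => hh ⟨h'.1, h'.2.le.trans h.le⟩)

/-- The du Bois-Reymond lemma: a locally integrable function with vanishing weak derivative is
almost everywhere constant. -/
theorem ae_eq_const_of_integral_mul_deriv_eq_zero {r : ℝ → ℝ} (hr : LocallyIntegrable r)
    (h : ∀ φ : ℝ → ℝ, ContDiff ℝ ∞ φ → HasCompactSupport φ → ∫ x, r x * deriv φ x = 0) :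
    ∃ C : ℝ, ∀ᵐ x, r x = C := by
  let b : ContDiffBump (0 : ℝ) := ⟨1, 2, one_pos, one_lt_two⟩
  set ρ : ℝ → ℝ := b.normed volume with hρ
  have hρs : ContDiff ℝ ∞ ρ := b.contDiff_normed
  have hρc : HasCompactSupport ρ := b.hasCompactSupport_normed
  have hρ1 : ∫ x, ρ x = 1 := b.integral_normed
  set C := ∫ x, r x * ρ x
  refine ⟨C, ?_⟩
  have hrC : LocallyIntegrable (fun x => r x - C) :=
    hr.sub (continuous_const.locallyIntegrable)
  suffices ∀ᵐ x, r x - C = 0 by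
    filter_upwards [this] with x hx using sub_eq_zero.mp hx
  refine ae_eq_zero_of_integral_contDiff_smul_eq_zero hrC fun ψ hψ hψc => ?_
  have iψ : Integrable ψ := hψ.continuous.integrable_of_hasCompactSupport hψc
  have iρ : Integrable ρ := hρs.continuous.integrable_of_hasCompactSupport hρc
  have irψ : Integrable fun x => r x * ψ x :=
    hr.integrable_smul_right_of_hasCompactSupport hψ.continuous hψc
  have irρ : Integrable fun x => r x * ρ x :=
    hr.integrable_smul_right_of_hasCompactSupport hρs.continuous hρc
  -- Subtracting a multiple of the mollifier makes the test function a derivative.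
  obtain ⟨η, hη, hηc, hηd⟩ := exists_antideriv (χ := fun x => ψ x - (∫ y, ψ y) * ρ x)
    (hψ.sub (contDiff_const.mul hρs)) (hψc.sub (hρc.mul_left)) (by
      rw [integral_sub iψ (iρ.const_mul _), integral_const_mul, hρ1]; ring)
  have key := h η hη hηc
  rw [hηd] at key
  have e1 : (fun x => r x * (ψ x - (∫ y, ψ y) * ρ x)) =
      fun x => r x * ψ x - (∫ y, ψ y) * (r x * ρ x) := by ext x; ring
  rw [e1, integral_sub irψ (irρ.const_mul _), integral_const_mul] at key
  have e2 : (fun x => ψ x • (r x - C)) = fun x => r x * ψ x - C * ψ x := by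
    ext x; simp only [smul_eq_mul]; ring
  rw [e2, integral_sub irψ (iψ.const_mul _), integral_const_mul]
  linarith

theorem IsWeakDeriv.ae_eq_const_add_integral {q g : ℝ → ℝ} (h : IsWeakDeriv q g) :
    ∃ C : ℝ, ∀ᵐ x, q x = C + ∫ t in (0 : ℝ)..x, g t := by
  obtain ⟨hq, hg, hw⟩ := h
  obtain ⟨hG, -, hGw⟩ := isWeakDeriv_integral hg
  obtain ⟨C, hC⟩ := ae_eq_const_of_integral_mul_deriv_eq_zero (hq.sub hG) fun φ hφ hc => by
    have hdc : Continuous (deriv φ) := hφ.continuous_deriv (by exact_mod_cast le_top)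
    have e : (fun x => (q - fun x => ∫ t in (0 : ℝ)..x, g t) x * deriv φ x) =
        fun x => q x * deriv φ x - (∫ t in (0 : ℝ)..x, g t) * deriv φ x := by
      ext x; simp only [Pi.sub_apply]; ring
    have i1 : Integrable fun x => q x * deriv φ x :=
      hq.integrable_smul_right_of_hasCompactSupport hdc hc.deriv
    have i2 : Integrable fun x => (∫ t in (0 : ℝ)..x, g t) * deriv φ x :=
      hG.integrable_smul_right_of_hasCompactSupport hdc hc.deriv
    rw [e, integral_sub i1 i2, hw φ hφ hc, hGw φ hφ hc, sub_self]
  exact ⟨C, hC.mono fun x hx => by simp only [Pi.sub_apply] at hx; linarith⟩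

theorem IsWeakDeriv.eq_add_integral {q g : ℝ → ℝ} (h : IsWeakDeriv q g) (hq : Continuous q)
    (x : ℝ) : q x = q 0 + ∫ t in (0 : ℝ)..x, g t := by
  obtain ⟨C, hC⟩ := h.ae_eq_const_add_integral
  have he : q = fun x => C + ∫ t in (0 : ℝ)..x, g t := (hq.ae_eq_iff_eq volume
    (continuous_const.add (continuous_integral_zero h.2.1))).mp hC
  have h0 := congrFun he 0
  have hx := congrFun he x
  simp only [intervalIntegral.integral_same, add_zero] at h0 hx
  rw [hx, h0]

theorem IsWeakDeriv.ae_unique {q g g' : ℝ → ℝ} (h : IsWeakDeriv q g) (h' : IsWeakDeriv q g') :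
    g =ᵐ[volume] g' := by
  refine ae_eq_of_integral_contDiff_smul_eq h.2.1 h'.2.1 fun φ hφ hc => ?_
  have := (h.2.2 φ hφ hc).symm.trans (h'.2.2 φ hφ hc)
  simpa [mul_comm] using this

theorem IsWeakDeriv.weakDeriv_ae_eq {q g : ℝ → ℝ} (h : IsWeakDeriv q g) :
    weakDeriv q =ᵐ[volume] g := by
  have hex : ∃ g, IsWeakDeriv q g := ⟨g, h⟩
  rw [weakDeriv, dif_pos hex]
  exact hex.choose_spec.ae_unique h

/-! ### The energy space as `L²` -/

/-- Square integrable functions on the line, the space of derivatives of profiles. -/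
noncomputable abbrev L2R := Lp ℝ 2 (volume : Measure ℝ)

/-- The primitive of `u ∈ L²` that vanishes at the origin. -/
noncomputable def prim (u : L2R) (x : ℝ) : ℝ := ∫ t in (0 : ℝ)..x, u t

theorem locallyIntegrable_coe (u : L2R) : LocallyIntegrable u :=
  (Lp.memLp u).locallyIntegrable one_le_two

theorem intervalIntegrable_coe (u : L2R) (a b : ℝ) : IntervalIntegrable u volume a b :=
  intervalIntegrable_of_locallyIntegrable (locallyIntegrable_coe u) a b

theorem continuous_prim (u : L2R) : Continuous (prim u) :=
  continuous_integral_zero (locallyIntegrable_coe u)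

theorem prim_sub_prim (u : L2R) (a b : ℝ) : prim u b - prim u a = ∫ t in a..b, u t :=
  intervalIntegral.integral_interval_sub_left (intervalIntegrable_coe u _ _)
    (intervalIntegrable_coe u _ _)

theorem isWeakDeriv_prim (u : L2R) : IsWeakDeriv (prim u) u :=
  isWeakDeriv_integral (locallyIntegrable_coe u)

theorem prim_add (u v : L2R) : prim (u + v) = prim u + prim v := by
  ext x
  rw [Pi.add_apply, prim, prim, prim, ← intervalIntegral.integral_add
    (intervalIntegrable_coe u _ _) (intervalIntegrable_coe v _ _)]
  refine intervalIntegral.integral_congr_ae ?_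
  filter_upwards [Lp.coeFn_add u v] with t ht _ using ht

theorem prim_smul (c : ℝ) (u : L2R) : prim (c • u) = c • prim u := by
  ext x
  rw [Pi.smul_apply, prim, prim, smul_eq_mul, ← intervalIntegral.integral_const_mul]
  refine intervalIntegral.integral_congr_ae ?_
  filter_upwards [Lp.coeFn_smul c u] with t ht _ using ht

theorem prim_mem_energySpace (u : L2R) : prim u ∈ energySpace :=
  ⟨continuous_prim u, ⟨u, isWeakDeriv_prim u⟩,
    (Lp.memLp u).ae_eq (isWeakDeriv_prim u).weakDeriv_ae_eq.symm, by simp [prim]⟩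

theorem exists_eq_prim {q : ℝ → ℝ} (hq : q ∈ energySpace) : ∃ u : L2R, q = prim u := by
  obtain ⟨hc, ⟨g, hg⟩, hm, h0⟩ := hq
  refine ⟨hm.toLp, funext fun x => ?_⟩
  rw [hg.eq_add_integral hc x, h0, zero_add, prim]
  refine intervalIntegral.integral_congr_ae ?_
  filter_upwards [hm.coeFn_toLp, hg.weakDeriv_ae_eq] with t h1 h2 _
  rw [h1, h2]

theorem norm_sq_eq_integral (u : L2R) : ‖u‖ ^ 2 = ∫ t, u t ^ 2 := by
  rw [← real_inner_self_eq_norm_sq, L2.inner_def]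
  simp [pow_two]

theorem integrable_sq_coe (u : L2R) : Integrable fun t => u t ^ 2 :=
  (Lp.memLp u).integrable_sq

theorem kineticEnergy_prim (u : L2R) : kineticEnergy (prim u) = 1 / 2 * ‖u‖ ^ 2 := by
  rw [kineticEnergy, norm_sq_eq_integral]
  congr 1
  refine integral_congr_ae ?_
  filter_upwards [(isWeakDeriv_prim u).weakDeriv_ae_eq] with t ht
  rw [ht]

/-- The Cauchy-Schwarz inequality for the increments of a primitive. -/
theorem sq_prim_sub_le (u : L2R) {a b : ℝ} (hab : a ≤ b) :
    (prim u b - prim u a) ^ 2 ≤ (b - a) * ∫ t in a..b, u t ^ 2 := by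
  rw [prim_sub_prim]
  rcases hab.eq_or_lt with rfl | hlt
  · simp
  have i1 := intervalIntegrable_coe u a b
  have i2 : IntervalIntegrable (fun t => u t ^ 2) volume a b :=
    (integrable_sq_coe u).intervalIntegrable
  set A := ∫ t in a..b, u t
  have hpos : 0 < b - a := by linarith
  -- The square of `u` minus its mean over the interval has nonnegative integral.
  have h : 0 ≤ ∫ t in a..b, (u t - A / (b - a)) ^ 2 :=
    intervalIntegral.integral_nonneg hab fun t _ => sq_nonneg _
  have e : (fun t => (u t - A / (b - a)) ^ 2) =
      fun t => u t ^ 2 - 2 * (A / (b - a)) * u t + (A / (b - a)) ^ 2 := by ext t; ring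
  rw [e, intervalIntegral.integral_add (i2.sub (i1.const_mul _)) (by simp),
    intervalIntegral.integral_sub i2 (i1.const_mul _), intervalIntegral.integral_const_mul,
    intervalIntegral.integral_const, smul_eq_mul] at h
  have h' := mul_nonneg hpos.le h
  have : (b - a) * (((∫ t in a..b, u t ^ 2) - 2 * (A / (b - a)) * A) +
      (b - a) * (A / (b - a)) ^ 2) = (b - a) * (∫ t in a..b, u t ^ 2) - A ^ 2 := by
    field_simp; ring
  linarith

theorem sq_prim_sub_le_norm (u : L2R) {a b : ℝ} (hab : a ≤ b) :
    (prim u b - prim u a) ^ 2 ≤ (b - a) * ‖u‖ ^ 2 := by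
  refine (sq_prim_sub_le u hab).trans (mul_le_mul_of_nonneg_left ?_ (by linarith))
  rw [norm_sq_eq_integral, intervalIntegral.integral_of_le hab]
  exact setIntegral_le_integral (integrable_sq_coe u) (ae_of_all _ fun t => sq_nonneg _)

theorem abs_prim_sub_le (u : L2R) (a b : ℝ) :
    |prim u b - prim u a| ≤ √|b - a| * ‖u‖ := by
  wlog hab : a ≤ b generalizing a b
  · rw [abs_sub_comm, abs_sub_comm b a]; exact this b a (le_of_not_ge hab)
  rw [abs_of_nonneg (sub_nonneg.mpr hab)]
  refine abs_le_of_sq_le_sq ?_ (mul_nonneg (Real.sqrt_nonneg _) (norm_nonneg u))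
  rw [mul_pow, Real.sq_sqrt (by linarith)]
  exact sq_prim_sub_le_norm u hab

/-- Weak convergence in a real Hilbert space, tested with the inner product. -/
def WeakTendsto {H : Type*} [NormedAddCommGroup H] [InnerProductSpace ℝ H] (w : ℕ → H) (u : H) :
    Prop :=
  ∀ v, Tendsto (fun n => inner ℝ (w n) v) atTop (𝓝 (inner ℝ u v))

theorem exists_weakTendsto_subseq {w : ℕ → L2R} {C : ℝ} (hw : ∀ n, ‖w n‖ ≤ C) :
    ∃ (u : L2R) (s : ℕ → ℕ), StrictMono s ∧ WeakTendsto (w ∘ s) u := by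
  have : Fact ((2 : ENNReal) ≠ ⊤) := ⟨by simp⟩
  obtain ⟨y, -, s, hs, ht⟩ := WeakDual.isSeqCompact_closedBall ℝ L2R (0 : StrongDual ℝ L2R) C
    (x := fun n => StrongDual.toWeakDual (InnerProductSpace.toDual ℝ L2R (w n)))
    (fun n => by
      refine mem_preimage.mpr (Metric.mem_closedBall.mpr ?_)
      rw [dist_zero_right]
      exact ((InnerProductSpace.toDual ℝ L2R).norm_map (w n)).le.trans (hw n))
  refine ⟨(InnerProductSpace.toDual ℝ L2R).symm (WeakDual.toStrongDual y), s, hs, fun v => ?_⟩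
  have := ((WeakDual.eval_continuous v).tendsto y).comp ht
  simpa [Function.comp_def] using this

theorem WeakTendsto.prim_sub {w : ℕ → L2R} {u : L2R} (h : WeakTendsto w u) (a b : ℝ) :
    Tendsto (fun n => prim (w n) b - prim (w n) a) atTop (𝓝 (prim u b - prim u a)) := by
  wlog hab : a ≤ b generalizing a b
  · simpa using (this b a (le_of_not_ge hab)).neg
  have key : ∀ v : L2R, prim v b - prim v a =
      inner ℝ v (indicatorConstLp 2 measurableSet_Ioc (measure_Ioc_lt_top (a := a) (b := b)).ne
        (1 : ℝ)) := fun v => by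
    rw [prim_sub_prim, intervalIntegral.integral_of_le hab, real_inner_comm,
      L2.inner_indicatorConstLp_one]
  simp_rw [key]
  exact h _

/-- Translation on `L²`, as a linear isometry. -/
noncomputable def shift (a : ℝ) : L2R →ₗᵢ[ℝ] L2R :=
  Lp.compMeasurePreservingₗᵢ ℝ (fun x => x + a) (measurePreserving_add_right volume a)

theorem prim_shift (a : ℝ) (u : L2R) (x : ℝ) :
    prim (shift a u) x = prim u (x + a) - prim u a := by
  have : prim (shift a u) x = ∫ t in (0 : ℝ)..x, u (t + a) := by
    refine intervalIntegral.integral_congr_ae ?_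
    filter_upwards [Lp.coeFn_compMeasurePreserving u (measurePreserving_add_right volume a)]
      with t ht _ using ht
  rw [this, prim_sub_prim, intervalIntegral.integral_comp_add_right (fun t => u t), zero_add]

/-! ### Even superquadratic profiles -/

/-- An even nonnegative profile `Φ` with derivative `φ`, superquadratic in `|x|`. Local Lipschitz
continuity of `φ` is all that is kept of the second derivative. -/
structure SuperquadraticProfile (Φ φ : ℝ → ℝ) : Prop where
  zero : Φ 0 = 0
  even : ∀ x, Φ (-x) = Φ x
  nonneg : ∀ x, 0 ≤ Φ x
  hasDerivAt : ∀ x, HasDerivAt Φ (φ x) x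
  lipschitz : ∀ M, ∃ C, 0 ≤ C ∧ ∀ x y, |x| ≤ M → |y| ≤ M → |φ x - φ y| ≤ C * |x - y|
  superquadratic : ∀ x y, 0 < x → x < y → Φ x / x ^ 2 < Φ y / y ^ 2

/-- The quadratic coefficient of a superquadratic profile at the origin, that is, the infimum of
`Φ x / x ^ 2`. -/
noncomputable def quadraticCoeff (Φ : ℝ → ℝ) : ℝ :=
  sInf ((fun x => Φ x / x ^ 2) '' Ioi 0)

namespace SuperquadraticProfile

variable {Φ φ : ℝ → ℝ} (h : SuperquadraticProfile Φ φ)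
include h

theorem continuous : Continuous Φ :=
  continuous_iff_continuousAt.mpr fun x => (h.hasDerivAt x).continuousAt

theorem continuous_deriv : Continuous φ := by
  refine continuous_iff_continuousAt.mpr fun x => ?_
  obtain ⟨C, hC, hL⟩ := h.lipschitz (|x| + 1)
  rw [ContinuousAt, tendsto_iff_dist_tendsto_zero]
  have hev : ∀ᶠ y in 𝓝 x, |y| ≤ |x| + 1 :=
    (continuous_abs.tendsto x).eventually (Iic_mem_nhds (by linarith))
  refine squeeze_zero' (Eventually.of_forall fun y => dist_nonneg)
    (hev.mono fun y hy => (hL y x hy (by linarith))) ?_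
  have : Continuous fun y => C * |y - x| := by fun_prop
  simpa using this.tendsto x

theorem deriv_zero : φ 0 = 0 := by
  have hm : IsLocalMin Φ 0 := Eventually.of_forall fun x => by rw [h.zero]; exact h.nonneg x
  exact hm.hasDerivAt_eq_zero (h.hasDerivAt 0)

theorem apply_abs (x : ℝ) : Φ |x| = Φ x := by
  rcases abs_choice x with e | e <;> rw [e]
  exact h.even x

theorem ratio_lt {x y : ℝ} (hx : x ≠ 0) (hxy : |x| < |y|) : Φ x / x ^ 2 < Φ y / y ^ 2 := by
  have := h.superquadratic |x| |y| (abs_pos.mpr hx) hxy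
  rwa [h.apply_abs, h.apply_abs, sq_abs, sq_abs] at this

theorem sq_mul_lt {t x : ℝ} (ht : 1 < t) (hx : x ≠ 0) : t ^ 2 * Φ x < Φ (t * x) := by
  have hx' : 0 < |x| := abs_pos.mpr hx
  have hlt : |x| < |t * x| := by
    rw [abs_mul, abs_of_pos (by linarith : 0 < t)]; nlinarith
  have hr := h.ratio_lt hx hlt
  have h2 : 0 < x ^ 2 := by positivity
  have h3 : 0 < t ^ 2 := by positivity
  rw [mul_pow, div_lt_div_iff₀ h2 (by positivity)] at hr
  nlinarith

theorem sq_mul_le {t : ℝ} (ht : 1 ≤ t) (x : ℝ) : t ^ 2 * Φ x ≤ Φ (t * x) := by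
  rcases eq_or_ne x 0 with rfl | hx
  · simp [h.zero]
  rcases ht.eq_or_lt with rfl | ht
  · simp
  exact (h.sq_mul_lt ht hx).le

theorem pos {x : ℝ} (hx : x ≠ 0) : 0 < Φ x := by
  have := h.sq_mul_lt one_lt_two (x := x / 2) (by simpa using hx)
  rw [mul_div_cancel₀ x two_ne_zero] at this
  nlinarith [h.nonneg (x / 2)]

theorem mono {x y : ℝ} (hxy : |x| ≤ |y|) : Φ x ≤ Φ y := by
  rcases eq_or_ne x 0 with rfl | hx
  · rw [h.zero]; exact h.nonneg y
  rcases hxy.eq_or_lt with e | hlt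
  · rw [← h.apply_abs x, e, h.apply_abs]
  have hr := h.ratio_lt hx hlt
  have hy : 0 < |y| := (abs_pos.mpr hx).trans hlt
  have hx2 : 0 < x ^ 2 := by positivity
  have hy2 : 0 < y ^ 2 := by rw [← sq_abs]; positivity
  rw [div_lt_div_iff₀ hx2 hy2] at hr
  have hsq : x ^ 2 ≤ y ^ 2 := sq_le_sq.mpr hxy
  by_contra hc
  push Not at hc
  nlinarith [h.nonneg y]

/-- Differentiating `t ^ 2 * Φ x ≤ Φ (t * x)` at `t = 1`. -/
theorem two_mul_le_deriv_mul (x : ℝ) : 2 * Φ x ≤ φ x * x := by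
  have hd : HasDerivAt (fun t => Φ (t * x)) (φ x * x) 1 := by
    have h1 : HasDerivAt Φ (φ x) ((1 : ℝ) * x) := by simpa using h.hasDerivAt x
    simpa [Function.comp_def] using h1.comp (1 : ℝ) ((hasDerivAt_id (1 : ℝ)).mul_const x)
  have ht := (hasDerivAt_iff_tendsto_slope.mp hd).mono_left
    (nhdsWithin_mono 1 fun t (ht : 1 < t) => ht.ne')
  have ht2 : Tendsto (fun t : ℝ => (t + 1) * Φ x) (𝓝[>] 1) (𝓝 (2 * Φ x)) := by
    have : Continuous fun t : ℝ => (t + 1) * Φ x := by fun_prop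
    have := this.tendsto 1
    norm_num at this
    exact this.mono_left nhdsWithin_le_nhds
  refine le_of_tendsto_of_tendsto ht2 ht ?_
  filter_upwards [self_mem_nhdsWithin] with t (htt : 1 < t)
  rw [slope_def_field, one_mul, le_div_iff₀ (by linarith)]
  nlinarith [h.sq_mul_le htt.le x]

theorem exists_quadratic_bound {M : ℝ} (hM : 0 ≤ M) :
    ∃ C, 0 ≤ C ∧ (∀ x, |x| ≤ M → |φ x| ≤ C * |x|) ∧ (∀ x, |x| ≤ M → Φ x ≤ C * x ^ 2) ∧
      ∀ x y, |x| ≤ M → |y| ≤ M → |Φ (x + y) - Φ x - Φ y| ≤ C * |x| * |y| := by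
  obtain ⟨C, hC, hL⟩ := h.lipschitz (M + M)
  have h1 : ∀ x, |x| ≤ M → |φ x| ≤ C * |x| := fun x hx => by
    simpa [h.deriv_zero] using hL x 0 (by linarith) (by simpa using add_nonneg hM hM)
  refine ⟨C, hC, h1, fun x hx => ?_, fun x y hx hy => ?_⟩
  · have := h.two_mul_le_deriv_mul x
    have h2 : φ x * x ≤ C * x ^ 2 := by
      calc φ x * x ≤ |φ x| * |x| := by rw [← abs_mul]; exact le_abs_self _
        _ ≤ C * |x| * |x| := by gcongr; exact h1 x hx
        _ = C * x ^ 2 := by rw [mul_assoc, ← pow_two, sq_abs]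
    nlinarith [h.nonneg x]
  · -- The increment in `y` of `Φ (x + y) - Φ y` has slope `φ (x + y) - φ y`.
    have hd : ∀ t, HasDerivAt (fun t => Φ (x + t) - Φ t) (φ (x + t) - φ t) t := fun t =>
      (HasDerivAt.comp_const_add x t (h.hasDerivAt (x + t))).sub (h.hasDerivAt t)
    have hb := (convex_Icc (-M) M).norm_image_sub_le_of_norm_hasDerivWithin_le
      (C := C * |x|) (f := fun t => Φ (x + t) - Φ t) (x := 0) (y := y)
      (fun t _ => (hd t).hasDerivWithinAt) (fun t ht => by
        have ht' : |t| ≤ M := abs_le.mpr ht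
        have := hL (x + t) t ((abs_add_le x t).trans (by linarith)) (by linarith)
        simpa using this)
      (by constructor <;> linarith) (abs_le.mp hy)
    simp only [add_zero, h.zero, sub_zero, Real.norm_eq_abs] at hb
    rwa [show Φ (x + y) - Φ x - Φ y = Φ (x + y) - Φ y - Φ x by ring]

theorem bddBelow_ratio : BddBelow ((fun x => Φ x / x ^ 2) '' Ioi 0) :=
  ⟨0, by rintro _ ⟨x, -, rfl⟩; exact div_nonneg (h.nonneg x) (sq_nonneg x)⟩

theorem quadraticCoeff_nonneg : 0 ≤ quadraticCoeff Φ :=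
  Real.sInf_nonneg (by rintro _ ⟨x, -, rfl⟩; exact div_nonneg (h.nonneg x) (sq_nonneg x))

theorem exists_le_of_quadraticCoeff_lt {b : ℝ} (hb : quadraticCoeff Φ < b) :
    ∃ s, 0 < s ∧ ∀ x, |x| ≤ s → Φ x ≤ b * x ^ 2 := by
  obtain ⟨_, ⟨s, hs, rfl⟩, hlt⟩ := exists_lt_of_csInf_lt (Set.nonempty_Ioi.image _) hb
  have hs' : 0 < s := hs
  refine ⟨s, hs', fun x hx => ?_⟩
  rcases eq_or_ne x 0 with rfl | hx0
  · simp [h.zero]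
  have hx2 : 0 < x ^ 2 := by positivity
  rw [← div_le_iff₀ hx2]
  refine le_trans ?_ hlt.le
  rcases hx.eq_or_lt with e | hl
  · rw [← h.apply_abs x, ← sq_abs x, e]
  · exact (h.ratio_lt hx0 (hl.trans_le (le_abs_self s))).le

theorem exists_quadraticCoeff_lt {s : ℝ} (hs : 0 < s) :
    ∃ b, quadraticCoeff Φ < b ∧ ∀ x, s ≤ |x| → b * x ^ 2 ≤ Φ x := by
  refine ⟨Φ s / s ^ 2, ?_, fun x hx => ?_⟩
  · exact (csInf_le h.bddBelow_ratio ⟨s / 2, half_pos hs, rfl⟩).trans_lt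
      (h.superquadratic _ _ (half_pos hs) (half_lt_self hs))
  · have hx0 : 0 < |x| := hs.trans_le hx
    have hx2 : 0 < x ^ 2 := by rw [← sq_abs]; positivity
    rw [← le_div_iff₀ hx2]
    rcases hx.eq_or_lt with e | hl
    · rw [← h.apply_abs x, ← sq_abs x, e]
    · exact (h.ratio_lt hs.ne' (by rwa [abs_of_pos hs])).le

end SuperquadraticProfile

/-! ### Energies of strain operators -/

/-- A linear operator `B` from a Hilbert space into functions on a measure space, bounded into `L∞`
(with constant `M`) and into `L²` (with constant `√β`), and turning weak convergence into pointwise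
convergence. -/
structure IsStrainOperator {H X : Type*} [NormedAddCommGroup H] [InnerProductSpace ℝ H]
    [MeasurableSpace X] (ν : Measure X) (B : H →ₗ[ℝ] X → ℝ) (M β : ℝ) : Prop where
  measurable : ∀ u, Measurable (B u)
  abs_le : ∀ u, ∀ᵐ x ∂ν, |B u x| ≤ M * ‖u‖
  integrable_sq : ∀ u, Integrable (fun x => B u x ^ 2) ν
  integral_sq_le : ∀ u, ∫ x, B u x ^ 2 ∂ν ≤ β * ‖u‖ ^ 2
  tendsto : ∀ (w : ℕ → H) (u : H), WeakTendsto w u →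
    ∀ x, Tendsto (fun n => B (w n) x) atTop (𝓝 (B u x))

section StrainEnergy

variable {H X : Type*} [NormedAddCommGroup H] [InnerProductSpace ℝ H] [MeasurableSpace X]

/-- The energy with density `Φ` of the strain `B u`. -/
noncomputable def strainEnergy (Φ : ℝ → ℝ) (ν : Measure X) (B : H →ₗ[ℝ] X → ℝ) (u : H) : ℝ :=
  ∫ x, Φ (B u x) ∂ν

/-- The directional derivative at `u` in the direction `v` of the energy whose density has the
derivative `φ`. -/
noncomputable def strainEnergyDeriv (φ : ℝ → ℝ) (ν : Measure X) (B : H →ₗ[ℝ] X → ℝ)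
    (u v : H) : ℝ :=
  ∫ x, φ (B u x) * B v x ∂ν

variable {Φ φ : ℝ → ℝ} (h : SuperquadraticProfile Φ φ) {ν : Measure X} {B : H →ₗ[ℝ] X → ℝ}
  {M β : ℝ} (hB : IsStrainOperator ν B M β)

include hB in
theorem IsStrainOperator.exists_abs_le (u : H) :
    ∃ R, 0 ≤ R ∧ ∀ᵐ x ∂ν, |B u x| ≤ R :=
  ⟨|M| * ‖u‖, by positivity, (hB.abs_le u).mono fun x hx =>
    hx.trans (mul_le_mul_of_nonneg_right (le_abs_self M) (norm_nonneg u))⟩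

include hB in
theorem IsStrainOperator.integrable_abs_mul (u v : H) :
    Integrable (fun x => |B u x| * |B v x|) ν := by
  refine ((hB.integrable_sq u).add (hB.integrable_sq v)).mono'
    (((hB.measurable _).abs).mul (hB.measurable _).abs).aestronglyMeasurable
    (ae_of_all _ fun x => ?_)
  rw [Real.norm_of_nonneg (by positivity)]
  simp only [Pi.add_apply]
  nlinarith [sq_abs (B u x), sq_abs (B v x), sq_nonneg (|B u x| - |B v x|),
    sq_nonneg (B u x), sq_nonneg (B v x)]

include h hB

theorem integrable_strainEnergy (u : H) : Integrable (fun x => Φ (B u x)) ν := by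
  obtain ⟨R, hR, hb⟩ := hB.exists_abs_le u
  obtain ⟨C, hC, -, hq, -⟩ := h.exists_quadratic_bound hR
  refine ((hB.integrable_sq u).const_mul C).mono'
    (h.continuous.measurable.comp (hB.measurable u)).aestronglyMeasurable ?_
  filter_upwards [hb] with x hx
  rw [Real.norm_of_nonneg (h.nonneg _)]
  exact hq _ hx

theorem integrable_strainEnergyDeriv (u v : H) :
    Integrable (fun x => φ (B u x) * B v x) ν := by
  obtain ⟨R, hR, hb⟩ := hB.exists_abs_le u
  obtain ⟨C, hC, hq, -, -⟩ := h.exists_quadratic_bound hR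
  refine ((hB.integrable_abs_mul u v).const_mul C).mono'
    ((h.continuous_deriv.measurable.comp (hB.measurable u)).mul
      (hB.measurable v)).aestronglyMeasurable ?_
  filter_upwards [hb] with x hx
  rw [norm_mul, Real.norm_eq_abs, Real.norm_eq_abs, ← mul_assoc]
  gcongr
  exact hq _ hx

omit hB in
theorem strainEnergy_nonneg (u : H) : 0 ≤ strainEnergy Φ ν B u :=
  integral_nonneg fun _ => h.nonneg _

omit hB in
theorem strainEnergy_zero : strainEnergy Φ ν B 0 = 0 := by
  simp [strainEnergy, h.zero]

theorem sq_mul_strainEnergy_le {t : ℝ} (ht : 1 ≤ t) (u : H) :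
    t ^ 2 * strainEnergy Φ ν B u ≤ strainEnergy Φ ν B (t • u) := by
  rw [strainEnergy, ← integral_const_mul]
  refine integral_mono ((integrable_strainEnergy h hB u).const_mul _)
    (integrable_strainEnergy h hB _) fun x => ?_
  simpa using h.sq_mul_le ht (B u x)

theorem sq_mul_strainEnergy_lt {t : ℝ} (ht : 1 < t) {u : H} (hu : 0 < strainEnergy Φ ν B u) :
    t ^ 2 * strainEnergy Φ ν B u < strainEnergy Φ ν B (t • u) := by
  have i1 := (integrable_strainEnergy h hB u).const_mul (t ^ 2)
  have i2 := integrable_strainEnergy h hB (t • u)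
  refine lt_of_le_of_ne (sq_mul_strainEnergy_le h hB ht.le u) fun he => hu.ne' ?_
  -- Equality of the integrals forces equality of the densities, hence vanishing strain.
  rw [strainEnergy, strainEnergy, ← integral_const_mul,
    integral_eq_iff_of_ae_le i1 i2 (ae_of_all _ fun x => by simpa using h.sq_mul_le ht.le (B u x))]
    at he
  refine (integral_congr_ae (he.mono fun x hx => ?_)).trans (integral_zero X ℝ)
  by_contra hne
  have hx0 : B u x ≠ 0 := fun h0 => hne (by simp [h0, h.zero])
  have := h.sq_mul_lt ht hx0
  simp only [map_smul, Pi.smul_apply, smul_eq_mul] at hx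
  exact this.ne hx

theorem strainEnergy_le_of_abs_le {b s : ℝ} (hb : 0 ≤ b) (hs : ∀ x, |x| ≤ s → Φ x ≤ b * x ^ 2)
    {u : H} (hu : ∀ᵐ x ∂ν, |B u x| ≤ s) : strainEnergy Φ ν B u ≤ b * (β * ‖u‖ ^ 2) := by
  refine le_trans ?_ (mul_le_mul_of_nonneg_left (hB.integral_sq_le u) hb)
  rw [strainEnergy, ← integral_const_mul]
  exact integral_mono_ae (integrable_strainEnergy h hB u) ((hB.integrable_sq u).const_mul b)
    (hu.mono fun x hx => hs _ hx)

theorem two_mul_strainEnergy_le (u : H) :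
    2 * strainEnergy Φ ν B u ≤ strainEnergyDeriv φ ν B u u := by
  rw [strainEnergy, ← integral_const_mul]
  exact integral_mono ((integrable_strainEnergy h hB u).const_mul 2)
    (integrable_strainEnergyDeriv h hB u u) fun x => h.two_mul_le_deriv_mul _

theorem strainEnergyDeriv_add (u v w : H) : strainEnergyDeriv φ ν B u (v + w) =
    strainEnergyDeriv φ ν B u v + strainEnergyDeriv φ ν B u w := by
  rw [strainEnergyDeriv, strainEnergyDeriv, strainEnergyDeriv,
    ← integral_add (integrable_strainEnergyDeriv h hB u v) (integrable_strainEnergyDeriv h hB u w)]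
  simp only [map_add, Pi.add_apply, mul_add]

omit h hB in
theorem strainEnergyDeriv_smul (u v : H) (c : ℝ) : strainEnergyDeriv φ ν B u (c • v) =
    c * strainEnergyDeriv φ ν B u v := by
  rw [strainEnergyDeriv, strainEnergyDeriv, ← integral_const_mul]
  simp only [map_smul, Pi.smul_apply, smul_eq_mul, mul_left_comm]

theorem hasDerivAt_strainEnergy (u v : H) :
    HasDerivAt (fun ε : ℝ => strainEnergy Φ ν B (u + ε • v)) (strainEnergyDeriv φ ν B u v) 0 := by
  obtain ⟨R, hR, hu⟩ := hB.exists_abs_le u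
  obtain ⟨S, hS, hv⟩ := hB.exists_abs_le v
  obtain ⟨C, hC, hq, -, -⟩ := h.exists_quadratic_bound (add_nonneg hR hS)
  have key := (hasDerivAt_integral_of_dominated_loc_of_deriv_le (μ := ν) (𝕜 := ℝ)
    (F := fun ε x => Φ (B (u + ε • v) x)) (F' := fun ε x => φ (B (u + ε • v) x) * B v x)
    (x₀ := (0 : ℝ)) (s := Metric.ball 0 1)
    (bound := fun x => C * (B u x ^ 2 + 2 * B v x ^ 2))
    (Metric.ball_mem_nhds 0 one_pos)
    (Eventually.of_forall fun ε => (integrable_strainEnergy h hB _).aestronglyMeasurable)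
    (integrable_strainEnergy h hB _)
    (integrable_strainEnergyDeriv h hB _ _).aestronglyMeasurable ?_
    (((hB.integrable_sq u).add ((hB.integrable_sq v).const_mul 2)).const_mul C) ?_).2
  · simpa [strainEnergy, strainEnergyDeriv] using key
  · filter_upwards [hu, hv] with x hux hvx ε hε
    have hε' : |ε| ≤ 1 := by simpa using (mem_ball_zero_iff.mp hε).le
    have hs : |B u x + ε * B v x| ≤ |B u x| + |B v x| := by
      refine (abs_add_le _ _).trans ?_
      rw [abs_mul]
      nlinarith [abs_nonneg (B v x)]
    simp only [map_add, map_smul, Pi.add_apply, Pi.smul_apply, smul_eq_mul, norm_mul,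
      Real.norm_eq_abs]
    calc |φ (B u x + ε * B v x)| * |B v x| ≤ C * |B u x + ε * B v x| * |B v x| := by
          gcongr; exact hq _ (hs.trans (add_le_add hux hvx))
      _ ≤ C * (|B u x| + |B v x|) * |B v x| := by gcongr
      _ = C * ((|B u x| + |B v x|) * |B v x|) := by ring
      _ ≤ C * (B u x ^ 2 + 2 * B v x ^ 2) := by
        gcongr
        nlinarith [sq_abs (B u x), sq_abs (B v x), sq_nonneg (|B u x| - |B v x|),
          sq_nonneg (B u x), sq_nonneg (B v x)]
  · refine ae_of_all _ fun x ε _ => ?_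
    have h1 : HasDerivAt (fun ε : ℝ => B u x + ε * B v x) (B v x) ε := by
      simpa using ((hasDerivAt_id ε).mul_const (B v x)).const_add (B u x)
    have h2 := (h.hasDerivAt (B u x + ε * B v x)).comp ε h1
    simpa [Function.comp_def] using h2

theorem continuous_strainEnergy_smul (u : H) :
    Continuous fun t : ℝ => strainEnergy Φ ν B (t • u) := by
  refine continuous_iff_continuousAt.mpr fun t => ?_
  have h1 := (hasDerivAt_strainEnergy h hB (t • u) u).continuousAt
  have h2 : ContinuousAt (fun r : ℝ => r - t) t := by fun_prop
  have h3 := ContinuousAt.comp_of_eq h1 h2 (sub_self t)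
  refine h3.congr (Eventually.of_forall fun r => ?_)
  simp only [Function.comp_apply]
  rw [← add_smul, add_sub_cancel]

omit h in
/-- Products with a fixed strain are weakly continuous. The product is split as
`|d y| ≤ ε d ^ 2 + (|d y| - ε d ^ 2)⁺`, whose second part is dominated by `y ^ 2 / (4 ε)`. -/
theorem tendsto_integral_abs_mul {w : ℕ → H} {u : H} (hw : WeakTendsto w u) {R : ℝ}
    (hR : ∀ n, ‖w n - u‖ ≤ R) :
    Tendsto (fun n => ∫ x, |B (w n - u) x| * |B u x| ∂ν) atTop (𝓝 0) := by
  have hint := fun n => hB.integrable_abs_mul (w n - u) u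
  have hRβ : ∀ n, ∫ x, B (w n - u) x ^ 2 ∂ν ≤ |β| * R ^ 2 := fun n =>
    (hB.integral_sq_le _).trans (by
      have h1 := pow_le_pow_left₀ (norm_nonneg _) (hR n) 2
      have h2 := le_abs_self β
      have h3 := sq_nonneg ‖w n - u‖
      nlinarith [abs_nonneg β])
  have hsplit : ∀ ε > 0, Tendsto
      (fun n => ∫ x, max (|B (w n - u) x| * |B u x| - ε * B (w n - u) x ^ 2) 0 ∂ν)
      atTop (𝓝 0) := fun ε hε => by
    rw [show 𝓝 (0 : ℝ) = 𝓝 (∫ _ : X, (0 : ℝ) ∂ν) by simp]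
    refine tendsto_integral_of_dominated_convergence (fun x => B u x ^ 2 / (4 * ε))
      (fun n => (((((hB.measurable _).abs).mul (hB.measurable _).abs).sub
        (((hB.measurable _).pow_const 2).const_mul ε)).max measurable_const).aestronglyMeasurable)
      ((hB.integrable_sq u).div_const _) (fun n => ae_of_all _ fun x => ?_)
      (ae_of_all _ fun x => ?_)
    · rw [Real.norm_of_nonneg (le_max_right _ _)]
      refine max_le ?_ (by positivity)
      rw [le_div_iff₀ (by positivity), ← sq_abs (B (w n - u) x), ← sq_abs (B u x)]
      linarith [sq_nonneg (2 * ε * |B (w n - u) x| - |B u x|)]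
    · have h0 : Tendsto (fun n => B (w n - u) x) atTop (𝓝 0) := by
        simpa using (hB.tendsto w u hw x).sub_const (B u x)
      have : Tendsto (fun n => max (|B (w n - u) x| * |B u x| - ε * B (w n - u) x ^ 2) 0) atTop
          (𝓝 (max (|0| * |B u x| - ε * 0 ^ 2) 0)) :=
        (((h0.abs).mul_const _).sub ((h0.pow 2).const_mul ε)).max tendsto_const_nhds
      simpa using this
  rw [Metric.tendsto_atTop]
  intro η hη
  set ε := η / (2 * (|β| * R ^ 2 + 1)) with hεdef
  have hden : 0 < |β| * R ^ 2 + 1 := by positivity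
  have hε : 0 < ε := by positivity
  obtain ⟨N, hN⟩ := (Metric.tendsto_atTop.mp (hsplit ε hε)) (η / 2) (half_pos hη)
  refine ⟨N, fun n hn => ?_⟩
  have h1 := hN n hn
  rw [Real.dist_0_eq_abs, abs_of_nonneg (integral_nonneg fun x => le_max_right _ _)] at h1
  rw [Real.dist_0_eq_abs, abs_of_nonneg (integral_nonneg fun x => by positivity)]
  have himax : Integrable
      (fun x => max (|B (w n - u) x| * |B u x| - ε * B (w n - u) x ^ 2) 0) ν :=
    ((hint n).sub ((hB.integrable_sq _).const_mul ε)).pos_part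
  have hle : ∫ x, |B (w n - u) x| * |B u x| ∂ν ≤
      ∫ x, (ε * B (w n - u) x ^ 2 +
        max (|B (w n - u) x| * |B u x| - ε * B (w n - u) x ^ 2) 0) ∂ν :=
    integral_mono (hint n) (((hB.integrable_sq _).const_mul ε).add himax) fun x => by
      have := le_max_left (|B (w n - u) x| * |B u x| - ε * B (w n - u) x ^ 2) 0
      simp only
      linarith
  rw [integral_add ((hB.integrable_sq _).const_mul ε) himax, integral_const_mul] at hle
  have h2 : ε * ∫ x, B (w n - u) x ^ 2 ∂ν ≤ η / 2 := by
    refine (mul_le_mul_of_nonneg_left (hRβ n) hε.le).trans ?_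
    rw [hεdef, div_mul_eq_mul_div, div_le_div_iff₀ (by positivity) two_pos]
    nlinarith
  linarith

/-- The Brezis-Lieb splitting of the energy along weakly convergent sequences. -/
theorem tendsto_strainEnergy_sub {w : ℕ → H} {u : H} (hw : WeakTendsto w u) {R : ℝ}
    (hR : ∀ n, ‖w n - u‖ ≤ R) :
    Tendsto (fun n => strainEnergy Φ ν B (w n) - strainEnergy Φ ν B (w n - u)) atTop
      (𝓝 (strainEnergy Φ ν B u)) := by
  have hR0 : 0 ≤ R := (norm_nonneg _).trans (hR 0)
  obtain ⟨S, hS, hu⟩ := hB.exists_abs_le u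
  obtain ⟨C, hC, -, -, hq⟩ := h.exists_quadratic_bound
    (add_nonneg hS (mul_nonneg (abs_nonneg M) hR0))
  rw [tendsto_iff_dist_tendsto_zero]
  have ht := (tendsto_integral_abs_mul hB hw hR).const_mul C
  rw [mul_zero] at ht
  refine squeeze_zero (fun n => dist_nonneg) (fun n => ?_) ht
  have i1 := integrable_strainEnergy h hB (w n)
  have i2 := integrable_strainEnergy h hB (w n - u)
  have i3 := integrable_strainEnergy h hB u
  have hint := hB.integrable_abs_mul (w n - u) u
  have i12 : Integrable (fun x => Φ (B (w n) x) - Φ (B (w n - u) x)) ν := i1.sub i2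
  rw [Real.dist_eq, strainEnergy, strainEnergy, strainEnergy, ← integral_sub i1 i2,
    ← integral_sub i12 i3, ← integral_const_mul]
  refine (abs_integral_le_integral_abs).trans
    (integral_mono_ae (i12.sub i3).abs (hint.const_mul C) ?_)
  filter_upwards [hu, hB.abs_le (w n - u)] with x hx hwx
  have h1 : |B (w n - u) x| ≤ S + |M| * R := by
    have : M * ‖w n - u‖ ≤ |M| * R :=
      mul_le_mul (le_abs_self M) (hR n) (norm_nonneg _) (abs_nonneg M)
    linarith
  have h2 : |B u x| ≤ S + |M| * R := by
    have : 0 ≤ |M| * R := by positivity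
    linarith
  have := hq _ _ h1 h2
  simpa [mul_assoc] using this

end StrainEnergy

/-! ### Constrained minimization in a Hilbert space -/

section Minimization

variable {H : Type*} [NormedAddCommGroup H] [InnerProductSpace ℝ H] {E : H → ℝ}

/-- A vector of energy above `K` can be scaled down to energy `K`, so that its norm is not
minimal. -/
theorem lt_norm_sq_of_lt_energy (hcont : ∀ u, Continuous fun t : ℝ => E (t • u)) (hzero : E 0 = 0)
    {K J : ℝ} (hK : 0 < K) (hJ : ∀ u, K ≤ E u → J ≤ ‖u‖ ^ 2) {u : H} (hu : K < E u) :
    J < ‖u‖ ^ 2 := by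
  have hu0 : u ≠ 0 := by rintro rfl; linarith
  obtain ⟨t, ht, hte⟩ := intermediate_value_Icc zero_le_one (hcont u).continuousOn
    (show K ∈ Icc (E ((0 : ℝ) • u)) (E ((1 : ℝ) • u)) by
      rw [zero_smul, one_smul, hzero]; exact ⟨hK.le, hu.le⟩)
  have ht1 : t ≠ 1 := by rintro rfl; simp only [one_smul] at hte; linarith
  have hlt : t < 1 := lt_of_le_of_ne ht.2 ht1
  have h1 := hJ (t • u) hte.ge
  rw [norm_smul, mul_pow, Real.norm_eq_abs, sq_abs] at h1
  have h2 : 0 < ‖u‖ ^ 2 := by positivity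
  have h3 : t ^ 2 < 1 := by nlinarith [ht.1]
  nlinarith

/-- The weak limit of a minimizing sequence for the norm under the constraint `K ≤ E` is a minimizer
as soon as its energy is positive. Superquadratic growth along rays makes the energy per squared
norm of every vector of smaller energy strictly worse than the optimal one, whence a minimizing
sequence cannot split into two parts. -/
theorem eq_of_minimizing_weakTendsto (hnn : ∀ u, 0 ≤ E u)
    (hcont : ∀ u, Continuous fun t : ℝ => E (t • u)) (hzero : E 0 = 0)
    (hle : ∀ (u : H) (t : ℝ), 1 ≤ t → t ^ 2 * E u ≤ E (t • u))
    (hlt : ∀ (u : H) (t : ℝ), 1 < t → 0 < E u → t ^ 2 * E u < E (t • u))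
    {K J : ℝ} (hK : 0 < K) (hJ : ∀ u, K ≤ E u → J ≤ ‖u‖ ^ 2) {w : ℕ → H} {u : H}
    (hwK : ∀ n, K ≤ E (w n)) (hwJ : Tendsto (fun n => ‖w n‖ ^ 2) atTop (𝓝 J))
    (hw : WeakTendsto w u) (hsplit : Tendsto (fun n => E (w n) - E (w n - u)) atTop (𝓝 (E u)))
    (hu : 0 < E u) : E u = K ∧ ‖u‖ ^ 2 = J := by
  have hJ0 : 0 ≤ J := ge_of_tendsto' hwJ fun n => sq_nonneg _
  have hdiff : Tendsto (fun n => ‖w n - u‖ ^ 2) atTop (𝓝 (J - ‖u‖ ^ 2)) := by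
    have h1 := (hwJ.sub ((hw u).const_mul 2)).add_const (‖u‖ ^ 2)
    rw [real_inner_self_eq_norm_sq] at h1
    have e : J - 2 * ‖u‖ ^ 2 + ‖u‖ ^ 2 = J - ‖u‖ ^ 2 := by ring
    rw [e] at h1
    exact h1.congr fun n => (norm_sub_sq_real (w n) u).symm
  have huJ : ‖u‖ ^ 2 ≤ J := by
    have := ge_of_tendsto' hdiff fun n => sq_nonneg _
    linarith
  rcases le_or_gt K (E u) with hKu | hKu
  · have hJu : ‖u‖ ^ 2 = J := le_antisymm huJ (hJ u hKu)
    refine ⟨(hKu.eq_or_lt.resolve_right fun hc => ?_).symm, hJu⟩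
    exact (lt_norm_sq_of_lt_energy hcont hzero hK hJ hc).ne' hJu
  exfalso
  -- Every vector of positive energy at most `K` is scaled up to energy at least `K`.
  have hscale : ∀ v, 0 < E v → E v < K → J * E v ≤ K * ‖v‖ ^ 2 := fun v hv hvK => by
    have ht : 1 ≤ √(K / E v) := by
      rw [Real.one_le_sqrt, one_le_div hv]; exact hvK.le
    have hsq : √(K / E v) ^ 2 = K / E v := Real.sq_sqrt (by positivity)
    have h1 := hle v _ ht
    rw [hsq, div_mul_cancel₀ _ hv.ne'] at h1
    have h2 := hJ _ h1
    rw [norm_smul, mul_pow, Real.norm_eq_abs, sq_abs, hsq, div_mul_eq_mul_div,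
      le_div_iff₀ hv] at h2
    exact h2
  have hstrict : J * E u < K * ‖u‖ ^ 2 := by
    have ht : 1 < √(K / E u) := by
      rw [Real.lt_sqrt zero_le_one, one_pow, one_lt_div hu]; exact hKu
    have hsq : √(K / E u) ^ 2 = K / E u := Real.sq_sqrt (by positivity)
    have h1 := hlt u _ ht hu
    rw [hsq, div_mul_cancel₀ _ hu.ne'] at h1
    have h2 := lt_norm_sq_of_lt_energy hcont hzero hK hJ h1
    rw [norm_smul, mul_pow, Real.norm_eq_abs, sq_abs, hsq, div_mul_eq_mul_div,
      lt_div_iff₀ hu] at h2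
    exact h2
  have hmin : ∀ v, J * min (E v) K ≤ K * ‖v‖ ^ 2 := fun v => by
    rcases le_or_gt K (E v) with hv | hv
    · rw [min_eq_right hv, mul_comm]
      exact mul_le_mul_of_nonneg_left (hJ v hv) hK.le
    · rw [min_eq_left hv.le]
      rcases (hnn v).eq_or_lt with h0 | h0
      · rw [← h0, mul_zero]; positivity
      · exact hscale v h0 hv
  have hlim : Tendsto (fun n => J * min (K - (E (w n) - E (w n - u))) K) atTop
      (𝓝 (J * min (K - E u) K)) :=
    ((tendsto_const_nhds.sub hsplit).min tendsto_const_nhds).const_mul J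
  have hfinal := le_of_tendsto_of_tendsto' hlim (hdiff.const_mul K) fun n =>
    (mul_le_mul_of_nonneg_left (min_le_min_right K (by linarith [hwK n])) hJ0).trans
      (hmin (w n - u))
  rw [min_eq_left (by linarith)] at hfinal
  nlinarith

/-- The Lagrange multiplier rule for the squared norm under the constraint `K ≤ E`. -/
theorem inner_eq_of_isMin {u : H} {D : H → ℝ} (hmin : ∀ v, E u ≤ E v → ‖u‖ ^ 2 ≤ ‖v‖ ^ 2)
    (hD : ∀ v, HasDerivAt (fun ε : ℝ => E (u + ε • v)) (D v) 0)
    (hadd : ∀ v w, D (v + w) = D v + D w) (hsmul : ∀ (v : H) (c : ℝ), D (c • v) = c * D v)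
    (hu : 0 < D u) (v : H) : inner ℝ u v = ‖u‖ ^ 2 / D u * D v := by
  -- Directions that increase the energy cannot decrease the norm.
  have hdir : ∀ v, 0 < D v → 0 ≤ inner ℝ u v := fun v hv => by
    have hs := (hasDerivAt_iff_tendsto_slope.mp (hD v)).eventually (lt_mem_nhds hv)
    have hs' : ∀ᶠ ε : ℝ in 𝓝[>] 0, 0 ≤ 2 * inner ℝ u v + ε * ‖v‖ ^ 2 := by
      filter_upwards [nhdsWithin_mono 0 (fun t (ht : (0 : ℝ) < t) => ht.ne') hs,
        self_mem_nhdsWithin] with ε hε (hpos : 0 < ε)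
      rw [slope_def_field] at hε
      have h1 : 0 < E (u + ε • v) - E u := by
        have := (div_pos_iff_of_pos_right (by linarith : 0 < ε - 0)).mp hε
        simpa using this
      have h2 := hmin (u + ε • v) (by linarith)
      rw [norm_add_sq_real, inner_smul_right, norm_smul, mul_pow, Real.norm_eq_abs, sq_abs] at h2
      have h3 : 0 ≤ ε * (2 * inner ℝ u v + ε * ‖v‖ ^ 2) := by nlinarith
      exact nonneg_of_mul_nonneg_right h3 hpos
    have hc : Tendsto (fun ε : ℝ => 2 * inner ℝ u v + ε * ‖v‖ ^ 2) (𝓝[>] 0)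
        (𝓝 (2 * inner ℝ u v)) := by
      have : Continuous fun ε : ℝ => 2 * inner ℝ u v + ε * ‖v‖ ^ 2 := by fun_prop
      have := this.tendsto 0
      rw [zero_mul, add_zero] at this
      exact this.mono_left nhdsWithin_le_nhds
    have := ge_of_tendsto hc hs'
    linarith
  have hle : ∀ v, ‖u‖ ^ 2 / D u * D v ≤ inner ℝ u v := fun v => by
    have hη : ∀ᶠ η : ℝ in 𝓝[>] 0, 0 ≤ inner ℝ u v - D v / D u * ‖u‖ ^ 2 + η * ‖u‖ ^ 2 := by
      filter_upwards [self_mem_nhdsWithin] with η (hη : 0 < η)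
      have h1 := hdir (v + (η - D v / D u) • u) (by
        rw [hadd, hsmul, sub_mul, div_mul_cancel₀ _ hu.ne']
        nlinarith)
      rw [inner_add_right, inner_smul_right, real_inner_self_eq_norm_sq] at h1
      linarith
    have hc : Tendsto (fun η : ℝ => inner ℝ u v - D v / D u * ‖u‖ ^ 2 + η * ‖u‖ ^ 2) (𝓝[>] 0)
        (𝓝 (inner ℝ u v - D v / D u * ‖u‖ ^ 2)) := by
      have : Continuous fun η : ℝ => inner ℝ u v - D v / D u * ‖u‖ ^ 2 + η * ‖u‖ ^ 2 := by
        fun_prop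
      have := this.tendsto 0
      rw [zero_mul, add_zero] at this
      exact this.mono_left nhdsWithin_le_nhds
    have h0 := ge_of_tendsto hc hη
    have e : ‖u‖ ^ 2 / D u * D v = D v / D u * ‖u‖ ^ 2 := by ring
    linarith
  refine le_antisymm ?_ (hle v)
  have h1 := hle (-v)
  have h2 : D (-v) = -D v := by simpa using hsmul v (-1)
  rw [h2, inner_neg_right] at h1
  linarith

end Minimization

/-! ### The bond strain -/

namespace ScalingAssumptions

variable {m k : ℝ → ℝ} {γ₂ δ : ℝ} (h : ScalingAssumptions m k γ₂ δ)
include h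

theorem m_pos {ξ : ℝ} (hξ : 0 < ξ) : 0 < m ξ := by
  have h0 : m 0 = 0 := (h.m_eq_zero_iff 0).mpr rfl
  have := h.m_mono (mem_Ici.mpr le_rfl) (mem_Ici.mpr hξ.le) hξ.le
  rw [h0] at this
  exact lt_of_le_of_ne this fun he => hξ.ne' ((h.m_eq_zero_iff ξ).mp he.symm)

theorem k_pos {ξ : ℝ} (hξ : 0 < ξ) : 0 < k ξ := by
  have h0 : k 0 = 0 := (h.k_eq_zero_iff 0).mpr rfl
  have := h.k_mono (mem_Ici.mpr le_rfl) (mem_Ici.mpr hξ.le) hξ.le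
  rw [h0] at this
  exact lt_of_le_of_ne this fun he => hξ.ne' ((h.k_eq_zero_iff ξ).mp he.symm)

theorem k_nonneg (ξ : ℝ) : 0 ≤ k ξ := by
  rcases lt_trichotomy ξ 0 with hξ | rfl | hξ
  · rw [← h.k_even]; exact (h.k_pos (by linarith)).le
  · exact ((h.k_eq_zero_iff 0).mpr rfl).ge
  · exact (h.k_pos hξ).le

theorem measurable_m : Measurable m := by
  have hm0 : ∀ x, 0 ≤ x → 0 ≤ m x := fun x hx => by
    rcases hx.eq_or_lt with rfl | hx
    · exact ((h.m_eq_zero_iff 0).mpr rfl).ge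
    · exact (h.m_pos hx).le
  refine Monotone.measurable fun x y hxy => ?_
  rcases le_total 0 x with hx | hx
  · exact h.m_mono hx (hx.trans hxy) hxy
  rcases le_total 0 y with hy | hy
  · have h1 := hm0 (-x) (by linarith)
    rw [h.m_odd] at h1
    linarith [hm0 y hy]
  · have h1 := h.m_mono (mem_Ici.mpr (by linarith : 0 ≤ -y)) (mem_Ici.mpr (by linarith : 0 ≤ -x))
      (by linarith)
    rw [h.m_odd, h.m_odd] at h1
    linarith

theorem measurable_k : Measurable k := by
  have hmono : Monotone fun ξ => k (max ξ 0) := fun x y hxy =>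
    h.k_mono (mem_Ici.mpr (le_max_right _ _)) (mem_Ici.mpr (le_max_right _ _))
      (max_le_max_right 0 hxy)
  have e : k = (fun ξ => k (max ξ 0)) ∘ fun ξ => |ξ| := by
    ext ξ
    simp only [Function.comp_apply, max_eq_left (abs_nonneg ξ)]
    rcases abs_choice ξ with e | e <;> rw [e]
    exact (h.k_even ξ).symm
  rw [e]
  exact hmono.measurable.comp measurable_id.abs

theorem m_le {x y : ℝ} (hx : 0 < x) (hxy : x ≤ y) : m x ≤ m y :=
  h.m_mono (mem_Ici.mpr hx.le) (mem_Ici.mpr (hx.le.trans hxy)) hxy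

theorem k_le {x y : ℝ} (hx : 0 < x) (hxy : x ≤ y) : k x ≤ k y :=
  h.k_mono (mem_Ici.mpr hx.le) (mem_Ici.mpr (hx.le.trans hxy)) hxy

end ScalingAssumptions

/-- The measure with density `k` on the bond lengths in `(ℓ, δ]`. -/
noncomputable def bondMeasure (k : ℝ → ℝ) (ℓ δ : ℝ) : Measure ℝ :=
  (volume.restrict (Ioc ℓ δ)).withDensity fun ξ => ENNReal.ofReal (k ξ)

/-- The scaled strain of the bond from `p.1` to `p.1 + p.2` under the displacement `q`. -/
noncomputable def bondStrain (m q : ℝ → ℝ) (p : ℝ × ℝ) : ℝ := (q (p.1 + p.2) - q p.1) / m p.2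

/-- The bond strain of `prim u`, as a linear operator in `u`. -/
noncomputable def bondStrainL (m : ℝ → ℝ) : L2R →ₗ[ℝ] ℝ × ℝ → ℝ where
  toFun u := bondStrain m (prim u)
  map_add' u v := by
    ext p
    simp only [bondStrain, prim_add, Pi.add_apply]
    ring
  map_smul' c u := by
    ext p
    simp only [bondStrain, prim_smul, Pi.smul_apply, smul_eq_mul, RingHom.id_apply]
    ring

theorem bondStrainL_apply (m : ℝ → ℝ) (u : L2R) (p : ℝ × ℝ) :
    bondStrainL m u p = (prim u (p.1 + p.2) - prim u p.1) / m p.2 := rfl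

theorem ae_bondMeasure_mem (k : ℝ → ℝ) (ℓ δ : ℝ) : ∀ᵐ ξ ∂bondMeasure k ℓ δ, ξ ∈ Ioc ℓ δ :=
  (withDensity_absolutelyContinuous _ _).ae_le (ae_restrict_mem measurableSet_Ioc)

instance sFinite_bondMeasure (k : ℝ → ℝ) (ℓ δ : ℝ) : SFinite (bondMeasure k ℓ δ) := by
  unfold bondMeasure; infer_instance

theorem ae_prod_bondMeasure_mem (k : ℝ → ℝ) (ℓ δ : ℝ) :
    ∀ᵐ p ∂(volume : Measure ℝ).prod (bondMeasure k ℓ δ), p.2 ∈ Ioc ℓ δ :=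
  Measure.quasiMeasurePreserving_snd.ae (ae_bondMeasure_mem k ℓ δ)

/-- The integrated squared increments of a primitive over bonds of a fixed length, estimated by the
Cauchy-Schwarz inequality on each bond and Tonelli's theorem. -/
theorem lintegral_sq_prim_sub_le (u : L2R) {ξ : ℝ} (hξ : 0 ≤ ξ) :
    ∫⁻ z, ENNReal.ofReal ((prim u (z + ξ) - prim u z) ^ 2) ≤ ENNReal.ofReal (ξ ^ 2 * ‖u‖ ^ 2) := by
  have hmeas : Measurable (u : ℝ → ℝ) := (Lp.stronglyMeasurable u).measurable
  have hpt : ∀ z, ENNReal.ofReal ((prim u (z + ξ) - prim u z) ^ 2) ≤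
      ENNReal.ofReal ξ * ∫⁻ s in Ioc 0 ξ, ENNReal.ofReal (u (s + z) ^ 2) := fun z => by
    have h1 := sq_prim_sub_le u (le_add_of_nonneg_right hξ : z ≤ z + ξ)
    have h2 : ∫ t in z..z + ξ, u t ^ 2 = ∫ s in (0 : ℝ)..ξ, u (s + z) ^ 2 := by
      rw [intervalIntegral.integral_comp_add_right (fun t => u t ^ 2), zero_add, add_comm]
    rw [h2, intervalIntegral.integral_of_le hξ, add_sub_cancel_left] at h1
    refine (ENNReal.ofReal_le_ofReal h1).trans ?_
    rw [ENNReal.ofReal_mul hξ, ofReal_integral_eq_lintegral_ofReal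
      ((integrable_sq_coe u).comp_add_right z).integrableOn (ae_of_all _ fun s => sq_nonneg _)]
  have hsq : ∫⁻ z, ENNReal.ofReal (u z ^ 2) = ENNReal.ofReal (‖u‖ ^ 2) := by
    rw [norm_sq_eq_integral, ofReal_integral_eq_lintegral_ofReal (integrable_sq_coe u)
      (ae_of_all _ fun s => sq_nonneg _)]
  calc ∫⁻ z, ENNReal.ofReal ((prim u (z + ξ) - prim u z) ^ 2)
      ≤ ∫⁻ z, ENNReal.ofReal ξ * ∫⁻ s in Ioc 0 ξ, ENNReal.ofReal (u (s + z) ^ 2) :=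
        lintegral_mono hpt
    _ = ENNReal.ofReal ξ * ∫⁻ z, ∫⁻ s in Ioc 0 ξ, ENNReal.ofReal (u (s + z) ^ 2) :=
        lintegral_const_mul' _ _ ENNReal.ofReal_ne_top
    _ = ENNReal.ofReal ξ * ∫⁻ s in Ioc 0 ξ, ∫⁻ z, ENNReal.ofReal (u (s + z) ^ 2) := by
        rw [lintegral_lintegral_swap]
        exact ((hmeas.comp (measurable_snd.add measurable_fst)).pow_const 2).ennreal_ofReal.aemeasurable
    _ = ENNReal.ofReal ξ * ∫⁻ _ in Ioc 0 ξ, ENNReal.ofReal (‖u‖ ^ 2) := by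
        congr 1
        refine lintegral_congr fun s => ?_
        rw [lintegral_add_left_eq_self (fun z => ENNReal.ofReal (u z ^ 2)) s, hsq]
    _ = ENNReal.ofReal (ξ ^ 2 * ‖u‖ ^ 2) := by
        rw [lintegral_const, Measure.restrict_apply_univ, Real.volume_Ioc, sub_zero,
          pow_two ξ, mul_assoc, ENNReal.ofReal_mul hξ, ENNReal.ofReal_mul hξ,
          mul_comm (ENNReal.ofReal ξ) (ENNReal.ofReal (‖u‖ ^ 2))]

/-- A bound for the square of the norm of the bond strain as an operator on `L²`; long intervals of
constant strain show that it is optimal. -/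
noncomputable def bondStiffness (m k : ℝ → ℝ) (ℓ δ : ℝ) : ℝ :=
  ∫ ξ, ξ ^ 2 / m ξ ^ 2 ∂bondMeasure k ℓ δ

section

variable {m k : ℝ → ℝ} {γ₂ δ ℓ : ℝ} (h : ScalingAssumptions m k γ₂ δ) (hℓ : 0 < ℓ)

include h hℓ

theorem isFiniteMeasure_bondMeasure : IsFiniteMeasure (bondMeasure k ℓ δ) := by
  refine isFiniteMeasure_withDensity_ofReal ?_
  refine (Measure.integrableOn_of_bounded (M := k δ) (measure_Ioc_lt_top).ne
    h.measurable_k.aestronglyMeasurable ?_).2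
  filter_upwards [ae_restrict_mem measurableSet_Ioc] with ξ hξ
  rw [Real.norm_of_nonneg (h.k_nonneg ξ)]
  exact h.k_le (hℓ.trans hξ.1) hξ.2

omit hℓ in
theorem integral_bondMeasure (hℓδ : ℓ ≤ δ) (g : ℝ → ℝ) :
    ∫ ξ, g ξ ∂bondMeasure k ℓ δ = ∫ ξ in ℓ..δ, g ξ * k ξ := by
  rw [bondMeasure, integral_withDensity_eq_integral_toReal_smul h.measurable_k.ennreal_ofReal
    (ae_of_all _ fun _ => ENNReal.ofReal_lt_top), intervalIntegral.integral_of_le hℓδ]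
  simp only [ENNReal.toReal_ofReal (h.k_nonneg _), smul_eq_mul, mul_comm]

theorem integrable_sq_div_sq : Integrable (fun ξ => ξ ^ 2 / m ξ ^ 2) (bondMeasure k ℓ δ) := by
  have := isFiniteMeasure_bondMeasure h hℓ
  refine Integrable.of_bound ((measurable_id.pow_const 2).div
    (h.measurable_m.pow_const 2)).aestronglyMeasurable (δ ^ 2 / m ℓ ^ 2) ?_
  filter_upwards [ae_bondMeasure_mem k ℓ δ] with ξ hξ
  have h1 := h.m_pos hℓ
  have h2 := hℓ.trans hξ.1
  rw [Real.norm_of_nonneg (by positivity)]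
  exact div_le_div₀ (sq_nonneg δ) (pow_le_pow_left₀ h2.le hξ.2 2) (by positivity)
    (pow_le_pow_left₀ h1.le (h.m_le hℓ hξ.1.le) 2)

omit hℓ in
theorem measurable_bondStrainL (u : L2R) : Measurable (bondStrainL m u) :=
  ((((continuous_prim u).measurable.comp (measurable_fst.add measurable_snd)).sub
    ((continuous_prim u).measurable.comp measurable_fst))).div
    (h.measurable_m.comp measurable_snd)

theorem abs_bondStrainL_le (u : L2R) {p : ℝ × ℝ} (hp : p.2 ∈ Ioc ℓ δ) :
    |bondStrainL m u p| ≤ √δ / m ℓ * ‖u‖ := by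
  have h1 := h.m_pos (hℓ.trans hp.1)
  have h2 := abs_prim_sub_le u p.1 (p.1 + p.2)
  rw [add_sub_cancel_left, abs_of_pos (hℓ.trans hp.1)] at h2
  rw [bondStrainL_apply, abs_div, abs_of_pos h1, div_mul_eq_mul_div]
  exact div_le_div₀ (by positivity)
    (h2.trans (mul_le_mul_of_nonneg_right (Real.sqrt_le_sqrt hp.2) (norm_nonneg u)))
    (h.m_pos hℓ) (h.m_le hℓ hp.1.le)

/-- Bond strains are controlled by the norm of the derivative, uniformly and in `L²`. -/
theorem isStrainOperator_bondStrainL :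
    IsStrainOperator ((volume : Measure ℝ).prod (bondMeasure k ℓ δ)) (bondStrainL m)
      (√δ / m ℓ) (bondStiffness m k ℓ δ) := by
  have hmeas := measurable_bondStrainL h
  have hβ : 0 ≤ bondStiffness m k ℓ δ :=
    integral_nonneg fun ξ => div_nonneg (sq_nonneg _) (sq_nonneg _)
  have hlint : ∀ u, ∫⁻ p, ENNReal.ofReal (bondStrainL m u p ^ 2)
      ∂(volume : Measure ℝ).prod (bondMeasure k ℓ δ) ≤
      ENNReal.ofReal (bondStiffness m k ℓ δ * ‖u‖ ^ 2) := fun u => by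
    rw [lintegral_prod_symm _ ((hmeas u).pow_const 2).ennreal_ofReal.aemeasurable]
    calc ∫⁻ ξ, (∫⁻ z, ENNReal.ofReal (bondStrainL m u (z, ξ) ^ 2)) ∂bondMeasure k ℓ δ
        ≤ ∫⁻ ξ, ENNReal.ofReal (ξ ^ 2 / m ξ ^ 2) * ENNReal.ofReal (‖u‖ ^ 2)
          ∂bondMeasure k ℓ δ := by
          refine lintegral_mono_ae ?_
          filter_upwards [ae_bondMeasure_mem k ℓ δ] with ξ hξ
          have hc : ∀ z, ENNReal.ofReal (bondStrainL m u (z, ξ) ^ 2) =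
              ENNReal.ofReal ((m ξ ^ 2)⁻¹) *
                ENNReal.ofReal ((prim u (z + ξ) - prim u z) ^ 2) := fun z => by
            rw [← ENNReal.ofReal_mul (by positivity), bondStrainL_apply, div_pow, div_eq_inv_mul]
          simp only [hc]
          rw [lintegral_const_mul' _ _ ENNReal.ofReal_ne_top]
          refine (mul_le_mul_right (lintegral_sq_prim_sub_le u (hℓ.trans hξ.1).le) _).trans ?_
          rw [← ENNReal.ofReal_mul (by positivity), ← ENNReal.ofReal_mul (by positivity)]
          exact ENNReal.ofReal_le_ofReal (le_of_eq (by ring))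
      _ = ENNReal.ofReal (bondStiffness m k ℓ δ * ‖u‖ ^ 2) := by
          rw [lintegral_mul_const' _ _ ENNReal.ofReal_ne_top, ENNReal.ofReal_mul hβ,
            bondStiffness, ofReal_integral_eq_lintegral_ofReal (integrable_sq_div_sq h hℓ)
              (ae_of_all _ fun ξ => div_nonneg (sq_nonneg _) (sq_nonneg _))]
  refine ⟨hmeas, fun u => ?_, fun u => ?_, fun u => ?_, fun w u hw p => ?_⟩
  · exact (ae_prod_bondMeasure_mem k ℓ δ).mono fun p hp => abs_bondStrainL_le h hℓ u hp
  · refine ⟨((hmeas u).pow_const 2).aestronglyMeasurable, ?_⟩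
    rw [hasFiniteIntegral_iff_ofReal (ae_of_all _ fun p => sq_nonneg _)]
    exact (hlint u).trans_lt ENNReal.ofReal_lt_top
  · rw [integral_eq_lintegral_of_nonneg_ae (ae_of_all _ fun p => sq_nonneg _)
      ((hmeas u).pow_const 2).aestronglyMeasurable]
    exact ENNReal.toReal_le_of_le_ofReal (by positivity) (hlint u)
  · exact (hw.prim_sub p.1 (p.1 + p.2)).div_const (m p.2)

theorem bondStiffness_pos (hℓδ : ℓ < δ) : 0 < bondStiffness m k ℓ δ := by
  rw [bondStiffness, integral_bondMeasure h hℓδ.le]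
  have hint : IntervalIntegrable (fun ξ => ξ ^ 2 / m ξ ^ 2 * k ξ) volume ℓ δ := by
    rw [intervalIntegrable_iff_integrableOn_Ioc_of_le hℓδ.le]
    refine Measure.integrableOn_of_bounded (M := δ ^ 2 / m ℓ ^ 2 * k δ) measure_Ioc_lt_top.ne
      (((measurable_id.pow_const 2).div (h.measurable_m.pow_const 2)).mul
        h.measurable_k).aestronglyMeasurable ?_
    filter_upwards [ae_restrict_mem measurableSet_Ioc] with ξ hξ
    have h1 := h.m_pos hℓ
    have h2 := hℓ.trans hξ.1
    have h3 := h.k_nonneg ξ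
    rw [Real.norm_of_nonneg (by positivity)]
    exact mul_le_mul (div_le_div₀ (sq_nonneg δ) (pow_le_pow_left₀ h2.le hξ.2 2) (by positivity)
      (pow_le_pow_left₀ h1.le (h.m_le hℓ hξ.1.le) 2)) (h.k_le h2 hξ.2) h3 (by positivity)
  refine intervalIntegral.intervalIntegral_pos_of_pos_on hint (fun ξ hξ => ?_) hℓδ
  have h2 := hℓ.trans hξ.1
  have := h.m_pos h2
  have := h.k_pos h2
  positivity

end

/-! ### Existence of minimizers -/

/-- The potential energy of the displacement `prim u`, as an integral over all bonds. -/
noncomputable abbrev bondEnergy (Φ m k : ℝ → ℝ) (ℓ δ : ℝ) (u : L2R) : ℝ :=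
  strainEnergy Φ ((volume : Measure ℝ).prod (bondMeasure k ℓ δ)) (bondStrainL m) u

section

variable {m k Φ φ : ℝ → ℝ} {γ₂ δ ℓ : ℝ} (h : ScalingAssumptions m k γ₂ δ) (hℓ : 0 < ℓ)
  (hΦ : SuperquadraticProfile Φ φ)

include h hℓ hΦ

/-- A long interval of constant strain stores more energy than the quadratic part of the profile
allows, because its bonds are all strained by a definite amount. -/
theorem exists_quadratic_lt_bondEnergy (hℓδ : ℓ < δ) :
    ∃ u : L2R, quadraticCoeff Φ * (bondStiffness m k ℓ δ * ‖u‖ ^ 2) < bondEnergy Φ m k ℓ δ u := by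
  have hδ : 0 < δ := hℓ.trans hℓδ
  have hmδ := h.m_pos hδ
  have hβ := bondStiffness_pos h hℓ hℓδ
  obtain ⟨b, hab, hb⟩ := hΦ.exists_quadraticCoeff_lt (div_pos hℓ hmδ)
  have ha := hΦ.quadraticCoeff_nonneg
  set a := quadraticCoeff Φ
  have hba : 0 < b - a := by linarith
  -- The length of the interval makes the loss at its end negligible.
  obtain ⟨L, hL⟩ : ∃ L, b * δ < (b - a) * L := by
    refine ⟨b * δ / (b - a) + 1, ?_⟩
    rw [mul_add, mul_div_cancel₀ _ hba.ne']; linarith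
  have hLδ : δ < L := by
    by_contra hc
    push Not at hc
    nlinarith [mul_le_mul_of_nonneg_left hc hba.le]
  have hL0 : 0 < L := hδ.trans hLδ
  set u : L2R := indicatorConstLp 2 measurableSet_Ioc (measure_Ioc_lt_top (a := 0) (b := L)).ne
    (1 : ℝ)
  have hone : ∀ᵐ t, t ∈ Ioc 0 L → u t = 1 := indicatorConstLp_coeFn_mem
  have hu : ‖u‖ ^ 2 = L := by
    have : ‖u‖ ^ 2 = inner ℝ u u := (real_inner_self_eq_norm_sq u).symm
    rw [this, L2.inner_indicatorConstLp_one, setIntegral_congr_ae measurableSet_Ioc (g := fun _ => 1)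
      hone]
    simp [hL0.le]
  have hprim : ∀ x, 0 ≤ x → x ≤ L → prim u x = x := fun x hx hxL => by
    rw [prim, intervalIntegral.integral_of_le hx,
      setIntegral_congr_ae measurableSet_Ioc (g := fun _ => 1)
      (hone.mono fun t ht hm => ht ⟨hm.1, hm.2.trans hxL⟩)]
    simp [hx]
  refine ⟨u, ?_⟩
  have hlow : b * (bondStiffness m k ℓ δ * (L - δ)) ≤ bondEnergy Φ m k ℓ δ u := by
    have e : b * (bondStiffness m k ℓ δ * (L - δ)) =
        ∫ p, (Icc 0 (L - δ)).indicator (fun _ => (1 : ℝ)) p.1 * (b * (p.2 ^ 2 / m p.2 ^ 2))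
          ∂(volume : Measure ℝ).prod (bondMeasure k ℓ δ) := by
      rw [integral_prod_mul (fun z => (Icc 0 (L - δ)).indicator (fun _ => (1 : ℝ)) z)
        (fun ξ => b * (ξ ^ 2 / m ξ ^ 2)), integral_const_mul, integral_indicator measurableSet_Icc]
      simp only [integral_const, MeasurableSet.univ, measureReal_restrict_apply, univ_inter,
        Real.volume_real_Icc, sub_zero, smul_eq_mul, mul_one, max_eq_left (by linarith : 0 ≤ L - δ)]
      rw [bondStiffness]; ring
    rw [e]
    have := isFiniteMeasure_bondMeasure (δ := δ) h hℓ
    refine integral_mono_ae (Integrable.mul_prod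
      ((integrable_indicator_iff measurableSet_Icc).mpr (by simp))
      ((integrable_sq_div_sq h hℓ).const_mul b))
      (integrable_strainEnergy hΦ (isStrainOperator_bondStrainL h hℓ) u) ?_
    filter_upwards [ae_prod_bondMeasure_mem k ℓ δ] with p hp
    have hp0 : 0 < p.2 := hℓ.trans hp.1
    by_cases hz : p.1 ∈ Icc 0 (L - δ)
    · rw [indicator_of_mem hz, one_mul, bondStrainL_apply, hprim p.1 hz.1 (by linarith [hz.2]),
        hprim (p.1 + p.2) (by linarith [hz.1]) (by linarith [hz.2, hp.2]), add_sub_cancel_left,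
        ← div_pow]
      refine hb _ ?_
      rw [abs_of_pos (div_pos hp0 (h.m_pos hp0))]
      exact div_le_div₀ hp0.le hp.1.le (h.m_pos hp0) (h.m_le hp0 hp.2)
    · rw [indicator_of_notMem hz, zero_mul]
      exact hΦ.nonneg _
  refine lt_of_lt_of_le ?_ hlow
  rw [hu]
  have : a * L < b * (L - δ) := by linarith
  nlinarith

theorem bondEnergy_shift (a : ℝ) (u : L2R) :
    bondEnergy Φ m k ℓ δ (shift a u) = bondEnergy Φ m k ℓ δ u := by
  have hB := isStrainOperator_bondStrainL (δ := δ) h hℓ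
  rw [bondEnergy, bondEnergy, strainEnergy, strainEnergy,
    integral_prod_symm _ (integrable_strainEnergy hΦ hB _),
    integral_prod_symm _ (integrable_strainEnergy hΦ hB _)]
  refine integral_congr_ae (ae_of_all _ fun ξ => ?_)
  simp only
  rw [← integral_add_right_eq_self (fun z => Φ (bondStrainL m u (z, ξ))) a]
  refine integral_congr_ae (ae_of_all _ fun z => ?_)
  simp only [bondStrainL_apply, prim_shift, sub_sub_sub_cancel_right, add_right_comm]

/-- A nonzero increment of the displacement over an admissible bond produces energy, since it
persists on an open set of bonds. -/
theorem bondEnergy_pos (hℓδ : ℓ < δ) {u : L2R} {ξ : ℝ} (hξ : ξ ∈ Icc ℓ δ)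
    (hu : prim u ξ ≠ prim u 0) : 0 < bondEnergy Φ m k ℓ δ u := by
  have hB := isStrainOperator_bondStrainL (δ := δ) h hℓ
  refine lt_of_le_of_ne (strainEnergy_nonneg hΦ u) fun h0 => ?_
  rw [bondEnergy, strainEnergy, eq_comm, integral_eq_zero_iff_of_nonneg (fun p => hΦ.nonneg _)
    (integrable_strainEnergy hΦ hB u)] at h0
  have hae : ∀ᵐ p ∂(volume : Measure ℝ).prod (bondMeasure k ℓ δ),
      prim u (p.1 + p.2) = prim u p.1 := by
    filter_upwards [h0, ae_prod_bondMeasure_mem k ℓ δ] with p hp hp2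
    by_contra hne
    refine (hΦ.pos (x := bondStrainL m u p) ?_).ne' hp
    exact div_ne_zero (sub_ne_zero.mpr hne) (h.m_pos (hℓ.trans hp2.1)).ne'
  have hac : (volume : Measure ℝ).restrict (Ioc ℓ δ) ≪ bondMeasure k ℓ δ := by
    refine withDensity_absolutelyContinuous' h.measurable_k.ennreal_ofReal.aemeasurable ?_
    filter_upwards [ae_restrict_mem measurableSet_Ioc] with x hx
    simpa using h.k_pos (hℓ.trans hx.1)
  have hae' := (Measure.AbsolutelyContinuous.prod (Measure.AbsolutelyContinuous.refl
    (volume : Measure ℝ)) hac).ae_le hae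
  set O : Set (ℝ × ℝ) := {p | prim u (p.1 + p.2) ≠ prim u p.1} with hO
  have hOo : IsOpen O := isOpen_ne_fun
    ((continuous_prim u).comp (continuous_fst.add continuous_snd))
    ((continuous_prim u).comp continuous_fst)
  have hmem : ((0 : ℝ), ξ) ∈ closure ((univ : Set ℝ) ×ˢ Ioo ℓ δ) := by
    rw [closure_prod_eq, closure_Ioo hℓδ.ne, closure_univ]
    exact ⟨mem_univ _, hξ⟩
  obtain ⟨p, hpO, hpI⟩ := mem_closure_iff.mp hmem O hOo (by simpa [hO] using hu)
  have hpos : 0 < (volume : Measure (ℝ × ℝ)) (O ∩ (univ ×ˢ Ioo ℓ δ)) :=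
    (hOo.inter (isOpen_univ.prod isOpen_Ioo)).measure_pos _ ⟨p, hpO, hpI⟩
  have hzero : ((volume : Measure ℝ).prod (volume.restrict (Ioc ℓ δ))) O = 0 := hae'
  have hr : (volume : Measure ℝ).prod (volume.restrict (Ioc ℓ δ)) =
      (volume : Measure (ℝ × ℝ)).restrict (univ ×ˢ Ioc ℓ δ) := by
    rw [Measure.volume_eq_prod, ← Measure.prod_restrict, Measure.restrict_univ]
  rw [hr, Measure.restrict_apply hOo.measurableSet] at hzero
  refine hpos.ne' (measure_mono_null (inter_subset_inter_right _ ?_) hzero)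
  exact prod_mono_right Ioo_subset_Ioc_self

/-- Below the quadratic threshold a sequence cannot vanish: translates of a subsequence have a weak
limit of positive energy. -/
theorem exists_shift_weakTendsto (hℓδ : ℓ < δ) {K J : ℝ} (hJ0 : 0 ≤ J)
    (hthr : quadraticCoeff Φ * (bondStiffness m k ℓ δ * J) < K) {w : ℕ → L2R}
    (hwK : ∀ n, K ≤ bondEnergy Φ m k ℓ δ (w n))
    (hwJ : Tendsto (fun n => ‖w n‖ ^ 2) atTop (𝓝 J)) :
    ∃ (v : ℕ → L2R) (u : L2R), (∀ n, K ≤ bondEnergy Φ m k ℓ δ (v n)) ∧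
      Tendsto (fun n => ‖v n‖ ^ 2) atTop (𝓝 J) ∧ WeakTendsto v u ∧
      0 < bondEnergy Φ m k ℓ δ u := by
  have hB := isStrainOperator_bondStrainL (δ := δ) h hℓ
  have hβ := bondStiffness_pos h hℓ hℓδ
  have ha := hΦ.quadraticCoeff_nonneg
  have hmℓ := h.m_pos hℓ
  set a := quadraticCoeff Φ
  set β := bondStiffness m k ℓ δ
  obtain ⟨b, hab, hbK⟩ : ∃ b, a < b ∧ b * (β * J) < K := by
    have hc : 0 ≤ β * J := by positivity
    refine ⟨a + (K - a * (β * J)) / (2 * (β * J + 1)), ?_, ?_⟩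
    · have : 0 < (K - a * (β * J)) / (2 * (β * J + 1)) := div_pos (by linarith) (by linarith)
      linarith
    · rw [add_mul, div_mul_eq_mul_div, ← lt_sub_iff_add_lt', div_lt_iff₀ (by linarith)]
      nlinarith
  obtain ⟨s, hs, hsb⟩ := hΦ.exists_le_of_quadraticCoeff_lt hab
  have hev : ∀ᶠ n in atTop, b * (β * ‖w n‖ ^ 2) < K :=
    ((hwJ.const_mul β).const_mul b).eventually (gt_mem_nhds hbK)
  obtain ⟨N, hN⟩ := eventually_atTop.mp hev
  have hpt : ∀ n, ∃ p : ℝ × ℝ, p.2 ∈ Ioc ℓ δ ∧ s < |bondStrainL m (w (n + N)) p| := fun n => by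
    by_contra hc
    push Not at hc
    have := strainEnergy_le_of_abs_le hΦ hB (ha.trans hab.le) hsb (u := w (n + N))
      ((ae_prod_bondMeasure_mem k ℓ δ).mono fun p hp => hc p hp)
    linarith [hwK (n + N), hN (n + N) (by omega)]
  choose p hp2 hps using hpt
  -- Translation moves the strained bond to the origin.
  set v : ℕ → L2R := fun n => shift (p n).1 (w (n + N)) with hv
  have hvnorm : ∀ n, ‖v n‖ = ‖w (n + N)‖ := fun n => (shift _).norm_map _
  have hvJ : Tendsto (fun n => ‖v n‖ ^ 2) atTop (𝓝 J) := by
    simp only [hvnorm]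
    exact (tendsto_add_atTop_iff_nat N).mpr hwJ
  have hvinc : ∀ n, s * m ℓ ≤ |prim (v n) (p n).2 - prim (v n) 0| := fun n => by
    have h1 := hps n
    have h2 := h.m_pos (hℓ.trans (hp2 n).1)
    rw [bondStrainL_apply, abs_div, abs_of_pos h2, lt_div_iff₀ h2] at h1
    simp only [hv, prim_shift, sub_sub_sub_cancel_right, zero_add]
    rw [add_comm (p n).2]
    exact (mul_le_mul_of_nonneg_left (h.m_le hℓ (hp2 n).1.le) hs.le).trans h1.le
  obtain ⟨R, hR⟩ : ∃ R, ∀ n, ‖v n‖ ≤ R := by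
    obtain ⟨R, hR⟩ := hvJ.bddAbove_range
    refine ⟨√R, fun n => Real.le_sqrt_of_sq_le (hR ⟨n, rfl⟩)⟩
  obtain ⟨ξ, hξ, σ, hσ, hσt⟩ := isCompact_Icc.tendsto_subseq
    (x := fun n => (p n).2) fun n => Ioc_subset_Icc_self (hp2 n)
  obtain ⟨u, τ, hτ, hu⟩ := exists_weakTendsto_subseq (w := v ∘ σ) fun n => hR (σ n)
  refine ⟨v ∘ σ ∘ τ, u, fun n => ?_, hvJ.comp (hσ.tendsto_atTop.comp hτ.tendsto_atTop), hu, ?_⟩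
  · simp only [Function.comp_apply, hv]
    rw [bondEnergy_shift h hℓ hΦ]
    exact hwK _
  refine bondEnergy_pos h hℓ hΦ hℓδ hξ fun heq => ?_
  have hlim1 : Tendsto (fun n => |prim ((v ∘ σ) (τ n)) ξ - prim ((v ∘ σ) (τ n)) 0|) atTop
      (𝓝 |prim u ξ - prim u 0|) := (hu.prim_sub 0 ξ).abs
  have hlim2 : Tendsto (fun n => √|(p (σ (τ n))).2 - ξ| * R) atTop (𝓝 0) := by
    have h1 : Tendsto (fun n => (p (σ (τ n))).2 - ξ) atTop (𝓝 0) := by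
      simpa using (hσt.comp hτ.tendsto_atTop).sub_const ξ
    simpa using (h1.abs.sqrt).mul_const R
  have hlow := ge_of_tendsto' (hlim1.add hlim2) (b := s * m ℓ) fun n => by
    have h1 := hvinc (σ (τ n))
    have h2 := (abs_prim_sub_le (v (σ (τ n))) ξ (p (σ (τ n))).2).trans
      (mul_le_mul_of_nonneg_left (hR _) (Real.sqrt_nonneg _))
    have h3 := abs_sub_le (prim (v (σ (τ n))) (p (σ (τ n))).2) (prim (v (σ (τ n))) ξ)
      (prim (v (σ (τ n))) 0)
    simp only [Function.comp_apply]
    linarith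
  rw [heq, sub_self, abs_zero, add_zero] at hlow
  linarith [mul_pos hs hmℓ]

/-- The norm has a minimizer under the constraint of a large energy. -/
theorem exists_minimizer (hℓδ : ℓ < δ) : ∃ K₀, 0 < K₀ ∧ ∀ K, K₀ < K →
    ∃ u : L2R, bondEnergy Φ m k ℓ δ u = K ∧
      ∀ v, K ≤ bondEnergy Φ m k ℓ δ v → ‖u‖ ^ 2 ≤ ‖v‖ ^ 2 := by
  have hB := isStrainOperator_bondStrainL (δ := δ) h hℓ
  have hβ := bondStiffness_pos h hℓ hℓδ
  have ha := hΦ.quadraticCoeff_nonneg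
  obtain ⟨u₀, hu₀⟩ := exists_quadratic_lt_bondEnergy h hℓ hΦ hℓδ
  set K₀ := bondEnergy Φ m k ℓ δ u₀
  have hK₀ : 0 < K₀ := lt_of_le_of_lt (by positivity) hu₀
  refine ⟨K₀, hK₀, fun K hK => ?_⟩
  have hK0 : 0 < K := hK₀.trans hK
  set S : Set ℝ := (fun u : L2R => ‖u‖ ^ 2) '' {u | K ≤ bondEnergy Φ m k ℓ δ u} with hS
  have hbdd : BddBelow S := ⟨0, by rintro _ ⟨u, -, rfl⟩; exact sq_nonneg _⟩
  have hsq : √(K / K₀) ^ 2 = K / K₀ := Real.sq_sqrt (by positivity)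
  have hmem : K / K₀ * ‖u₀‖ ^ 2 ∈ S := by
    refine ⟨√(K / K₀) • u₀, ?_, ?_⟩
    · have := sq_mul_strainEnergy_le hΦ hB (t := √(K / K₀))
        (by rw [Real.one_le_sqrt, one_le_div hK₀]; exact hK.le) u₀
      rwa [hsq, div_mul_cancel₀ _ hK₀.ne'] at this
    · simp only
      rw [norm_smul, mul_pow, Real.norm_eq_abs, sq_abs, hsq]
  set J := sInf S
  have hJ : ∀ u, K ≤ bondEnergy Φ m k ℓ δ u → J ≤ ‖u‖ ^ 2 := fun u hu => csInf_le hbdd ⟨u, hu, rfl⟩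
  have hJ0 : 0 ≤ J := le_csInf ⟨_, hmem⟩ (by rintro _ ⟨u, -, rfl⟩; exact sq_nonneg _)
  have hthr : quadraticCoeff Φ * (bondStiffness m k ℓ δ * J) < K := by
    have h1 : J ≤ K / K₀ * ‖u₀‖ ^ 2 := csInf_le hbdd hmem
    calc quadraticCoeff Φ * (bondStiffness m k ℓ δ * J)
        ≤ quadraticCoeff Φ * (bondStiffness m k ℓ δ * (K / K₀ * ‖u₀‖ ^ 2)) := by gcongr
      _ = K / K₀ * (quadraticCoeff Φ * (bondStiffness m k ℓ δ * ‖u₀‖ ^ 2)) := by ring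
      _ < K / K₀ * K₀ := mul_lt_mul_of_pos_left hu₀ (by positivity)
      _ = K := div_mul_cancel₀ _ hK₀.ne'
  obtain ⟨x, -, hxt, hxS⟩ := exists_seq_tendsto_sInf ⟨_, hmem⟩ hbdd
  choose w hwK hwx using hxS
  obtain ⟨v, u, hvK, hvJ, hvu, hu⟩ := exists_shift_weakTendsto h hℓ hΦ hℓδ hJ0 hthr (w := w) hwK
    (by simpa only [hwx] using hxt)
  obtain ⟨R, hR⟩ : ∃ R, ∀ n, ‖v n - u‖ ≤ R := by
    obtain ⟨R, hR⟩ := hvJ.bddAbove_range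
    exact ⟨√R + ‖u‖, fun n => (norm_sub_le _ _).trans
      (add_le_add_left (Real.le_sqrt_of_sq_le (hR ⟨n, rfl⟩)) _)⟩
  obtain ⟨huK, huJ⟩ := eq_of_minimizing_weakTendsto (E := bondEnergy Φ m k ℓ δ)
    (fun u => strainEnergy_nonneg hΦ u) (fun u => continuous_strainEnergy_smul hΦ hB u)
    (strainEnergy_zero hΦ) (fun u t ht => sq_mul_strainEnergy_le hΦ hB ht u)
    (fun u t ht hu => sq_mul_strainEnergy_lt hΦ hB ht hu) hK0 hJ hvK hvJ hvu
    (tendsto_strainEnergy_sub hΦ hB hvu hR) hu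
  exact ⟨u, huK, fun v hv => huJ.le.trans (hJ v hv)⟩

end

/-! ### The Euler-Lagrange equation -/

/-- The total force at `z` exerted by all bonds under the displacement `prim u`. -/
noncomputable def bondForceSum (φ m k : ℝ → ℝ) (ℓ δ : ℝ) (u : L2R) (z : ℝ) : ℝ :=
  ∫ ξ, (φ (bondStrainL m u (z, ξ)) / m ξ - φ (bondStrainL m u (z - ξ, ξ)) / m ξ)
    ∂bondMeasure k ℓ δ

/-- A function in `L²` whose weak derivative is continuous has a primitive of class `C²`. -/
theorem contDiff_two_prim {u : L2R} {G : ℝ → ℝ} (hu : IsWeakDeriv u G) (hG : Continuous G) :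
    ContDiff ℝ 2 (prim u) ∧ ∀ x, iteratedDeriv 2 (prim u) x = G x := by
  obtain ⟨C, hC⟩ := hu.ae_eq_const_add_integral
  have hd2 : ∀ x, HasDerivAt (fun x => C + ∫ t in (0 : ℝ)..x, G t) (G x) x := fun x =>
    ((hG.integral_hasStrictDerivAt 0 x).hasDerivAt).const_add C
  have hcont : Continuous fun x => C + ∫ t in (0 : ℝ)..x, G t :=
    continuous_iff_continuousAt.mpr fun x => (hd2 x).continuousAt
  have hprim : prim u = fun x => ∫ t in (0 : ℝ)..x, (C + ∫ s in (0 : ℝ)..t, G s) := by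
    ext x
    exact intervalIntegral.integral_congr_ae (hC.mono fun t ht _ => ht)
  have hd1 : ∀ x, HasDerivAt (prim u) (C + ∫ t in (0 : ℝ)..x, G t) x := fun x => by
    rw [hprim]
    exact (hcont.integral_hasStrictDerivAt 0 x).hasDerivAt
  have e1 : deriv (prim u) = fun x => C + ∫ t in (0 : ℝ)..x, G t := funext fun x => (hd1 x).deriv
  have e2 : deriv (fun x => C + ∫ t in (0 : ℝ)..x, G t) = G := funext fun x => (hd2 x).deriv
  refine ⟨?_, fun x => ?_⟩
  · rw [show (2 : WithTop ℕ∞) = 1 + 1 by norm_num, contDiff_succ_iff_deriv]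
    refine ⟨fun x => (hd1 x).differentiableAt, by simp, ?_⟩
    rw [e1, contDiff_one_iff_deriv, e2]
    exact ⟨fun x => (hd2 x).differentiableAt, hG⟩
  · rw [iteratedDeriv_succ, iteratedDeriv_one, e1, e2]

section

variable {m k Φ φ : ℝ → ℝ} {γ₂ δ ℓ : ℝ} (h : ScalingAssumptions m k γ₂ δ) (hℓ : 0 < ℓ)
  (hΦ : SuperquadraticProfile Φ φ)

include h hℓ hΦ

theorem exists_abs_force_le (u : L2R) : ∃ C, 0 ≤ C ∧ ∀ p : ℝ × ℝ, p.2 ∈ Ioc ℓ δ →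
    |φ (bondStrainL m u p) / m p.2| ≤ C := by
  have hmℓ := h.m_pos hℓ
  have hR : 0 ≤ √δ / m ℓ * ‖u‖ := by positivity
  obtain ⟨C, hC, hq, -, -⟩ := hΦ.exists_quadratic_bound hR
  refine ⟨C * (√δ / m ℓ * ‖u‖) / m ℓ, by positivity, fun p hp => ?_⟩
  have h1 := abs_bondStrainL_le h hℓ u hp
  rw [abs_div, abs_of_pos (h.m_pos (hℓ.trans hp.1))]
  exact div_le_div₀ (by positivity) ((hq _ h1).trans (mul_le_mul_of_nonneg_left h1 hC)) hmℓ
    (h.m_le hℓ hp.1.le)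

omit hℓ in
theorem measurable_force (u : L2R) :
    Measurable fun p : ℝ × ℝ => φ (bondStrainL m u p) / m p.2 :=
  (hΦ.continuous_deriv.measurable.comp (measurable_bondStrainL h u)).div
    (h.measurable_m.comp measurable_snd)

omit hℓ in
theorem measurable_force_shift (u : L2R) :
    Measurable fun p : ℝ × ℝ => φ (bondStrainL m u (p.1 - p.2, p.2)) / m p.2 :=
  (measurable_force h hΦ u).comp ((measurable_fst.sub measurable_snd).prodMk measurable_snd)

theorem continuous_bondForceSum (u : L2R) : Continuous (bondForceSum φ m k ℓ δ u) := by
  have := isFiniteMeasure_bondMeasure (δ := δ) h hℓ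
  obtain ⟨C, hC, hb⟩ := exists_abs_force_le (δ := δ) h hℓ hΦ u
  refine continuous_of_dominated (bound := fun _ => C + C) (fun z => ?_) (fun z => ?_)
    (integrable_const _) (ae_of_all _ fun ξ => ?_)
  · exact (((measurable_force h hΦ u).comp measurable_prodMk_left).sub
      ((measurable_force_shift h hΦ u).comp
        (measurable_prodMk_left (x := z)))).aestronglyMeasurable
  · filter_upwards [ae_bondMeasure_mem k ℓ δ] with ξ hξ
    exact (norm_sub_le _ _).trans (add_le_add (hb (z, ξ) hξ) (hb (z - ξ, ξ) hξ))
  · have hq := continuous_prim u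
    have hφ := hΦ.continuous_deriv
    simp only [bondStrainL_apply]
    fun_prop

/-- Summation by parts: the derivative of the energy in the direction of a test function `η` is
`-∫ η F`, where `F` is the total force. -/
theorem strainEnergyDeriv_test (u v : L2R) {η : ℝ → ℝ} (hη : Continuous η)
    (hηc : HasCompactSupport η) (hv : ∀ x, prim v x = η x - η 0) :
    strainEnergyDeriv φ ((volume : Measure ℝ).prod (bondMeasure k ℓ δ)) (bondStrainL m) u v =
      -∫ z, bondForceSum φ m k ℓ δ u z * η z := by
  have := isFiniteMeasure_bondMeasure (δ := δ) h hℓ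
  have hB := isStrainOperator_bondStrainL (δ := δ) h hℓ
  obtain ⟨C, hC, hb⟩ := exists_abs_force_le (δ := δ) h hℓ hΦ u
  set ν := (volume : Measure ℝ).prod (bondMeasure k ℓ δ)
  have hηi : Integrable (fun p : ℝ × ℝ => η p.1) ν := by
    simpa using (hη.integrable_of_hasCompactSupport hηc).mul_prod
      (integrable_const (1 : ℝ) (μ := bondMeasure k ℓ δ))
  have i1 : Integrable (fun p : ℝ × ℝ => φ (bondStrainL m u p) / m p.2 * η p.1) ν := by
    refine (hηi.norm.const_mul C).mono' ((measurable_force h hΦ u).mul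
      (hη.measurable.comp measurable_fst)).aestronglyMeasurable ?_
    filter_upwards [ae_prod_bondMeasure_mem k ℓ δ] with p hp
    rw [norm_mul]
    exact mul_le_mul_of_nonneg_right (hb p hp) (norm_nonneg _)
  have i2 : Integrable
      (fun p : ℝ × ℝ => φ (bondStrainL m u (p.1 - p.2, p.2)) / m p.2 * η p.1) ν := by
    refine (hηi.norm.const_mul C).mono' ((measurable_force_shift h hΦ u).mul
      (hη.measurable.comp measurable_fst)).aestronglyMeasurable ?_
    filter_upwards [ae_prod_bondMeasure_mem k ℓ δ] with p hp
    rw [norm_mul]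
    exact mul_le_mul_of_nonneg_right (hb (p.1 - p.2, p.2) hp) (norm_nonneg _)
  have i0 := integrable_strainEnergyDeriv hΦ hB u v
  have e0 : ∀ p : ℝ × ℝ, φ (bondStrainL m u p) * bondStrainL m v p =
      φ (bondStrainL m u p) / m p.2 * η (p.1 + p.2) - φ (bondStrainL m u p) / m p.2 * η p.1 :=
    fun p => by rw [bondStrainL_apply m v, hv, hv]; ring
  have i3 : Integrable (fun p : ℝ × ℝ => φ (bondStrainL m u p) / m p.2 * η (p.1 + p.2)) ν := by
    refine (i0.add i1).congr (ae_of_all _ fun p => ?_)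
    simp only [Pi.add_apply, e0]
    ring
  have hshift : ∫ p, φ (bondStrainL m u p) / m p.2 * η (p.1 + p.2) ∂ν =
      ∫ p, φ (bondStrainL m u (p.1 - p.2, p.2)) / m p.2 * η p.1 ∂ν := by
    rw [integral_prod_symm _ i3, integral_prod_symm _ i2]
    refine integral_congr_ae (ae_of_all _ fun ξ => ?_)
    simp only
    rw [← integral_sub_right_eq_self
      (fun z => φ (bondStrainL m u (z, ξ)) / m ξ * η (z + ξ)) ξ]
    simp only [sub_add_cancel]
  have i21 : Integrable (fun p : ℝ × ℝ => φ (bondStrainL m u (p.1 - p.2, p.2)) / m p.2 * η p.1 -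
      φ (bondStrainL m u p) / m p.2 * η p.1) ν := i2.sub i1
  rw [strainEnergyDeriv]
  simp only [e0]
  rw [integral_sub i3 i1, hshift, ← integral_sub i2 i1, integral_prod _ i21,
    ← integral_neg]
  refine integral_congr_ae (ae_of_all _ fun z => ?_)
  simp only
  rw [bondForceSum, ← integral_mul_const, ← integral_neg]
  refine integral_congr_ae (ae_of_all _ fun ξ => ?_)
  simp only
  ring

/-- The multiplier rule, tested with compactly supported functions, identifies the weak second
derivative of the displacement. -/
theorem isWeakDeriv_of_inner_eq {u : L2R} {μ : ℝ}
    (hμ : ∀ v, inner ℝ u v = μ * strainEnergyDeriv φ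
      ((volume : Measure ℝ).prod (bondMeasure k ℓ δ)) (bondStrainL m) u v) :
    IsWeakDeriv u fun z => μ * bondForceSum φ m k ℓ δ u z := by
  refine ⟨locallyIntegrable_coe u,
    (continuous_const.mul (continuous_bondForceSum h hℓ hΦ u)).locallyIntegrable,
    fun η hη hηc => ?_⟩
  have hd : Continuous (deriv η) := hη.continuous_deriv (by exact_mod_cast le_top)
  have hm : MemLp (deriv η) 2 volume := hd.memLp_of_hasCompactSupport hηc.deriv
  have hv : ∀ x, prim hm.toLp x = η x - η 0 := fun x => by
    rw [← intervalIntegral.integral_deriv_eq_sub' η rfl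
      (fun y _ => (hη.differentiable (by simp)).differentiableAt) hd.continuousOn]
    exact intervalIntegral.integral_congr_ae (hm.coeFn_toLp.mono fun t ht _ => ht)
  have key := hμ hm.toLp
  rw [strainEnergyDeriv_test h hℓ hΦ u _ hη.continuous hηc hv, L2.inner_def] at key
  simp only [mul_assoc]
  rw [integral_const_mul, ← mul_neg, ← key]
  refine integral_congr_ae ?_
  filter_upwards [hm.coeFn_toLp] with x hx
  rw [hx]
  simp [mul_comm]

end

/-! ### The symmetrized profile -/

/-- The derivative of the even extension of `g` from the half line `[0, ∞)`. -/
noncomputable def evenDeriv (g : ℝ → ℝ) (x : ℝ) : ℝ := if 0 ≤ x then deriv g x else -deriv g (-x)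

theorem hasDerivAt_comp_abs {g : ℝ → ℝ} (hg : Differentiable ℝ g) (h0 : deriv g 0 = 0) (x : ℝ) :
    HasDerivAt (fun x => g |x|) (evenDeriv g x) x := by
  rcases lt_trichotomy x 0 with hx | rfl | hx
  · have h1 : HasDerivAt (fun x => g (-x)) (evenDeriv g x) x := by
      simpa [evenDeriv, not_le.mpr hx, Function.comp_def] using
        (hg (-x)).hasDerivAt.comp x (hasDerivAt_neg x)
    refine h1.congr_of_eventuallyEq ?_
    filter_upwards [gt_mem_nhds hx] with y hy
    rw [abs_of_neg hy]
  · have e : evenDeriv g 0 = 0 := by simp [evenDeriv, h0]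
    have h1 : HasDerivAt g 0 0 := by simpa [h0] using (hg 0).hasDerivAt
    have h2 : HasDerivAt (fun x => g (-x)) 0 0 := by
      have h1' : HasDerivAt g 0 (-0) := by simpa using h1
      simpa [Function.comp_def] using h1'.comp (0 : ℝ) (hasDerivAt_neg 0)
    rw [e, ← hasDerivWithinAt_univ, ← Iic_union_Ici (a := (0 : ℝ))]
    refine HasDerivWithinAt.union ?_ ?_
    · exact h2.hasDerivWithinAt.congr (fun y (hy : y ≤ 0) => by rw [abs_of_nonpos hy]) (by simp)
    · exact h1.hasDerivWithinAt.congr (fun y (hy : 0 ≤ y) => by rw [abs_of_nonneg hy]) (by simp)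
  · have h1 : HasDerivAt g (evenDeriv g x) x := by
      simpa [evenDeriv, hx.le] using (hg x).hasDerivAt
    refine h1.congr_of_eventuallyEq ?_
    filter_upwards [lt_mem_nhds hx] with y hy
    rw [abs_of_pos hy]

theorem superquadraticProfile_comp_abs {g : ℝ → ℝ} (hg : ContDiff ℝ 2 g) (h0 : g 0 = 0)
    (hd0 : deriv g 0 = 0) (hmono : MonotoneOn g (Ici 0))
    (hsq : ∀ x y, 0 < x → x < y → g x / x ^ 2 < g y / y ^ 2) :
    SuperquadraticProfile (fun x => g |x|) (evenDeriv g) where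
  zero := by simp [h0]
  even x := by simp
  nonneg x := by
    have := hmono (mem_Ici.mpr le_rfl) (mem_Ici.mpr (abs_nonneg x)) (abs_nonneg x)
    rwa [h0] at this
  hasDerivAt := hasDerivAt_comp_abs (hg.differentiable (by simp)) hd0
  lipschitz M := by
    have hg1 : ContDiff ℝ 1 (deriv g) := by
      rw [show (2 : WithTop ℕ∞) = 1 + 1 by norm_num, contDiff_succ_iff_deriv] at hg
      exact hg.2.2
    obtain ⟨C, hC⟩ := (hg1.contDiffOn (s := Icc (-M) M)).exists_lipschitzOnWith (by decide)
      (convex_Icc _ _) isCompact_Icc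
    have hL : ∀ x y, |x| ≤ M → |y| ≤ M → |deriv g x - deriv g y| ≤ C * |x - y| :=
      fun x y hx hy => by
        simpa [Real.dist_eq] using hC.dist_le_mul x (abs_le.mp hx) y (abs_le.mp hy)
    have hcross : ∀ x y, |x| ≤ M → |y| ≤ M → x < 0 → 0 ≤ y →
        |evenDeriv g x - evenDeriv g y| ≤ C * |x - y| := fun x y hx hy hx0 hy0 => by
      have hM : |(0 : ℝ)| ≤ M := by simpa using (abs_nonneg x).trans hx
      have h1 := hL (-x) 0 (by rwa [abs_neg]) hM
      have h2 := hL y 0 hy hM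
      rw [hd0, sub_zero, sub_zero, abs_of_pos (by linarith : 0 < -x)] at h1
      rw [hd0, sub_zero, sub_zero, abs_of_nonneg hy0] at h2
      rw [evenDeriv, evenDeriv, if_neg (not_le.mpr hx0), if_pos hy0, abs_sub_comm x,
        abs_of_nonneg (by linarith : 0 ≤ y - x)]
      calc |-deriv g (-x) - deriv g y| ≤ |deriv g (-x)| + |deriv g y| := by
            simpa using abs_sub (-deriv g (-x)) (deriv g y)
        _ ≤ C * (y - x) := by linarith
    refine ⟨C, C.2, fun x y hx hy => ?_⟩
    rcases lt_or_ge x 0 with hx0 | hx0 <;> rcases lt_or_ge y 0 with hy0 | hy0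
    · rw [evenDeriv, evenDeriv, if_neg (not_le.mpr hx0), if_neg (not_le.mpr hy0), neg_sub_neg]
      have := hL (-y) (-x) (by rwa [abs_neg]) (by rwa [abs_neg])
      rwa [neg_sub_neg] at this
    · exact hcross x y hx hy hx0 hy0
    · rw [abs_sub_comm, abs_sub_comm x]
      exact hcross y x hy hx hy0 hx0
    · rw [evenDeriv, evenDeriv, if_pos hx0, if_pos hy0]
      exact hL x y hx hy
  superquadratic x y hx hxy := by
    simpa [abs_of_pos hx, abs_of_pos (hx.trans hxy)] using hsq x y hx hxy

/-- The orientation of the half line: `1` for `[0, ∞)`, and `-1` for `(-∞, 0]`. -/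
structure IsOrientation (I : Set ℝ) (σ : ℝ) : Prop where
  mem_iff : ∀ x, x ∈ I ↔ 0 ≤ σ * x
  sq : σ * σ = 1

theorem ProfileAssumptions.exists_orientation {V : ℝ → ℝ} {I : Set ℝ} {c₁ c₂ γ₁ γ₂ : ℝ}
    (h : ProfileAssumptions V I c₁ c₂ γ₁ γ₂) :
    ∃ σ, IsOrientation I σ ∧ (I = Ici 0 → σ = 1) ∧ (I = Iic 0 → σ = -1) := by
  rcases h.halfLine with rfl | rfl
  · refine ⟨1, ⟨fun x => by simp, by norm_num⟩, fun _ => rfl, fun e => ?_⟩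
    have : (1 : ℝ) ∈ Iic (0 : ℝ) := e ▸ (mem_Ici.mpr zero_le_one)
    norm_num at this
  · refine ⟨-1, ⟨fun x => by simp, by norm_num⟩, fun e => ?_, fun _ => rfl⟩
    have : (1 : ℝ) ∈ Iic (0 : ℝ) := e ▸ (mem_Ici.mpr zero_le_one)
    norm_num at this

namespace IsOrientation

variable {I : Set ℝ} {σ : ℝ} (hσ : IsOrientation I σ)
include hσ

theorem abs_eq_one : |σ| = 1 := by
  have : |σ| * |σ| = 1 := by rw [← abs_mul, hσ.sq, abs_one]
  nlinarith [abs_nonneg σ]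

theorem symmetrized_eq (V : ℝ → ℝ) : symmetrized V I = fun x => V (σ * |x|) := by
  ext x
  have hcases : σ = 1 ∨ σ = -1 := mul_self_eq_one_iff.mp hσ.sq
  by_cases hx : x ∈ I
  · rw [symmetrized, if_pos hx]
    have h0 := (hσ.mem_iff x).mp hx
    rcases hcases with rfl | rfl
    · rw [abs_of_nonneg (by linarith), one_mul]
    · rw [abs_of_nonpos (by linarith)]; simp
  · rw [symmetrized, if_neg hx]
    have h0 := not_le.mp (mt (hσ.mem_iff x).mpr hx)
    rcases hcases with rfl | rfl
    · rw [abs_of_neg (by linarith), one_mul]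
    · rw [abs_of_pos (by linarith)]; simp

end IsOrientation

section

variable {V : ℝ → ℝ} {I : Set ℝ} {c₁ c₂ γ₁ γ₂ σ : ℝ}
  (h : ProfileAssumptions V I c₁ c₂ γ₁ γ₂) (hσ : IsOrientation I σ)
include h

theorem ProfileAssumptions.hasDerivAt_oriented (σ x : ℝ) :
    HasDerivAt (fun x => V (σ * x)) (deriv V (σ * x) * σ) x := by
  have h1 : HasDerivAt V (deriv V (σ * x)) (σ * x) :=
    (h.contDiff.differentiable (by simp) _).hasDerivAt
  simpa [Function.comp_def] using h1.comp x ((hasDerivAt_id x).const_mul σ)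

include hσ

theorem ProfileAssumptions.superquadraticProfile :
    SuperquadraticProfile (symmetrized V I) (evenDeriv fun x => V (σ * x)) := by
  rw [hσ.symmetrized_eq]
  have hsmooth : ContDiff ℝ 2 fun x => V (σ * x) :=
    h.contDiff.comp (contDiff_const.mul contDiff_id)
  have hmem : ∀ x, 0 ≤ x → σ * x ∈ I := fun x hx =>
    (hσ.mem_iff _).mpr (by rw [← mul_assoc, hσ.sq, one_mul]; exact hx)
  refine superquadraticProfile_comp_abs hsmooth
    (by simp [h.zero]) ?_ (fun x hx y hy hxy => ?_) (fun x y hx hxy => ?_)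
  · rw [(h.hasDerivAt_oriented σ 0).deriv, mul_zero, h.deriv_zero, zero_mul]
  · have h1 := hmem x hx
    have h2 := hmem y hy
    rcases mul_self_eq_one_iff.mp hσ.sq with rfl | rfl
    · refine h.monotoneOn ?_ h1 h2 (by simpa using hxy)
      ext z; rw [hσ.mem_iff]; simp
    · refine h.antitoneOn ?_ h2 h1 (by simpa using hxy)
      ext z; rw [hσ.mem_iff]; simp
  · have hy := hx.trans hxy
    have hσ0 : σ ≠ 0 := fun h0 => by simpa [h0] using hσ.sq
    have := h.superquadraticOn _ (hmem x hx.le) _ (hmem y hy.le) (mul_ne_zero hσ0 hx.ne')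
      (by rw [abs_mul, abs_mul, hσ.abs_eq_one, one_mul, one_mul, abs_of_pos hx, abs_of_pos hy]
          exact hxy)
    rwa [mul_pow, mul_pow, pow_two σ, hσ.sq, one_mul, one_mul] at this

/-- On the half line `I` the symmetrized profile has the same derivative as `V`. -/
theorem evenDeriv_eq_deriv {x : ℝ} (hx : x ∈ I) :
    evenDeriv (fun x => V (σ * x)) x = deriv V x := by
  have h0 := (hσ.mem_iff x).mp hx
  rw [evenDeriv, (h.hasDerivAt_oriented σ x).deriv, (h.hasDerivAt_oriented σ (-x)).deriv]
  rcases mul_self_eq_one_iff.mp hσ.sq with rfl | rfl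
  · rw [if_pos (by linarith)]; simp
  · rcases eq_or_ne x 0 with rfl | hne
    · simp [h.deriv_zero]
    · have : x < 0 := lt_of_le_of_ne (by linarith) hne
      rw [if_neg (not_le.mpr this)]; simp

end

/-! ### The variational problem in terms of displacements -/

theorem hasDerivAt_kineticEnergy (u v : L2R) :
    HasDerivAt (fun ε : ℝ => kineticEnergy (prim u + ε • prim v)) (inner ℝ u v) 0 := by
  have e : (fun ε : ℝ => kineticEnergy (prim u + ε • prim v)) =
      fun ε => 1 / 2 * (‖u‖ ^ 2 + 2 * (ε * inner ℝ u v) + ε ^ 2 * ‖v‖ ^ 2) := by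
    ext ε
    rw [← prim_smul, ← prim_add, kineticEnergy_prim, norm_add_sq_real, inner_smul_right, norm_smul,
      mul_pow, Real.norm_eq_abs, sq_abs]
  rw [e]
  have h1 := ((((hasDerivAt_id (0 : ℝ)).mul_const (inner ℝ u v)).const_mul 2).const_add
    (‖u‖ ^ 2)).add (((hasDerivAt_id (0 : ℝ)).pow 2).mul_const (‖v‖ ^ 2))
  have h2 := h1.const_mul (1 / 2)
  refine (h2.congr_deriv ?_)
  simp

theorem bondForce_eq {Φ m k : ℝ → ℝ} {η ξ φ : ℝ} (h : HasDerivAt Φ φ (η / m ξ)) :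
    bondForce (micropotential Φ m k) η ξ = φ / m ξ * k ξ := by
  have h1 := (h.comp η ((hasDerivAt_id η).div_const (m ξ))).mul_const (k ξ)
  have h2 : HasDerivAt (fun η' => micropotential Φ m k η' ξ) (φ / m ξ * k ξ) η := by
    refine h1.congr_deriv ?_
    ring
  exact h2.deriv

section

variable {m k Φ φ : ℝ → ℝ} {γ₂ δ ℓ : ℝ} (h : ScalingAssumptions m k γ₂ δ) (hℓ : 0 < ℓ)
  (hΦ : SuperquadraticProfile Φ φ)

omit hΦ in
include h in
theorem energyDensity_prim (hℓδ : ℓ ≤ δ) (u : L2R) (z : ℝ) :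
    energyDensity (micropotential Φ m k) ℓ δ (prim u) z =
      ∫ ξ, Φ (bondStrainL m u (z, ξ)) ∂bondMeasure k ℓ δ := by
  rw [integral_bondMeasure h hℓδ]
  rfl

include h hℓ hΦ

theorem integrable_energyDensity_prim (hℓδ : ℓ ≤ δ) (u : L2R) :
    Integrable (energyDensity (micropotential Φ m k) ℓ δ (prim u)) := by
  rw [funext (energyDensity_prim h hℓδ u)]
  exact (integrable_strainEnergy hΦ (isStrainOperator_bondStrainL h hℓ) u).integral_prod_left

theorem potentialEnergy_prim (hℓδ : ℓ ≤ δ) (u : L2R) :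
    potentialEnergy (micropotential Φ m k) ℓ δ (prim u) = bondEnergy Φ m k ℓ δ u := by
  rw [potentialEnergy, funext (energyDensity_prim h hℓδ u), bondEnergy, strainEnergy,
    integral_prod _ (integrable_strainEnergy hΦ (isStrainOperator_bondStrainL h hℓ) u)]

omit h hℓ in
theorem bondEnergy_neg (u : L2R) : bondEnergy Φ m k ℓ δ (-u) = bondEnergy Φ m k ℓ δ u := by
  rw [bondEnergy, bondEnergy, strainEnergy, strainEnergy]
  simp only [map_neg, Pi.neg_apply, hΦ.even]

theorem bondEnergy_le_abs (u : L2R) : bondEnergy Φ m k ℓ δ u ≤ bondEnergy Φ m k ℓ δ |u| := by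
  have hB := isStrainOperator_bondStrainL (δ := δ) h hℓ
  refine integral_mono_ae (integrable_strainEnergy hΦ hB u) (integrable_strainEnergy hΦ hB |u|) ?_
  filter_upwards [ae_prod_bondMeasure_mem k ℓ δ] with p hp
  have hp0 := hℓ.trans hp.1
  have habs : ∀ a b : ℝ, prim |u| b - prim |u| a = ∫ t in a..b, |u t| := fun a b => by
    rw [prim_sub_prim]
    exact intervalIntegral.integral_congr_ae ((Lp.coeFn_abs u).mono fun t ht _ => ht)
  refine hΦ.mono ?_
  rw [bondStrainL_apply, bondStrainL_apply, abs_div, abs_div, habs, prim_sub_prim]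
  exact div_le_div_of_nonneg_right
    ((intervalIntegral.abs_integral_le_integral_abs (by linarith)).trans (le_abs_self _))
    (abs_nonneg _)

/-- Taking the absolute value of the derivative turns a minimizer into a monotone one. -/
theorem exists_monotone_minimizer (hℓδ : ℓ < δ) : ∃ K₀, 0 < K₀ ∧ ∀ K, K₀ < K →
    ∃ u : L2R, Monotone (prim u) ∧ bondEnergy Φ m k ℓ δ u = K ∧
      ∀ v, K ≤ bondEnergy Φ m k ℓ δ v → ‖u‖ ^ 2 ≤ ‖v‖ ^ 2 := by
  have hB := isStrainOperator_bondStrainL (δ := δ) h hℓ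
  obtain ⟨K₀, hK₀, hmin⟩ := exists_minimizer h hℓ hΦ hℓδ
  refine ⟨K₀, hK₀, fun K hK => ?_⟩
  obtain ⟨u, huK, hu⟩ := hmin K hK
  refine ⟨|u|, fun a b hab => ?_, ?_, ?_⟩
  · rw [← sub_nonneg, prim_sub_prim]
    refine intervalIntegral.integral_nonneg_of_ae hab ?_
    filter_upwards [Lp.coeFn_abs u] with t ht
    rw [ht]
    exact abs_nonneg _
  · refine le_antisymm ?_ (huK ▸ bondEnergy_le_abs h hℓ hΦ u)
    by_contra hc
    push Not at hc
    have := lt_norm_sq_of_lt_energy (E := bondEnergy Φ m k ℓ δ)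
      (fun u => continuous_strainEnergy_smul hΦ hB u) (strainEnergy_zero hΦ) (hK₀.trans hK) hu hc
    rw [norm_abs_eq_norm] at this
    exact lt_irrefl _ this
  · rw [norm_abs_eq_norm]
    exact hu

omit hℓ hΦ in
/-- The equation may be written with any profile whose derivative agrees with `φ` on a set that
contains all strains. -/
theorem solvesTravellingWave_prim (hℓδ : ℓ ≤ δ) {Ψ ψ : ℝ → ℝ} {S : Set ℝ} {u : L2R} {c : ℝ}
    (hΨ : ∀ x ∈ S, HasDerivAt Ψ (ψ x) x) (hφ : ∀ x ∈ S, φ x = ψ x)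
    (hS : ∀ p : ℝ × ℝ, p.2 ∈ Ioc ℓ δ → bondStrainL m u p ∈ S)
    (hc : ∀ x, c ^ 2 * iteratedDeriv 2 (prim u) x = bondForceSum φ m k ℓ δ u x) :
    SolvesTravellingWave (bondForce (micropotential Ψ m k)) ℓ δ c (prim u) := fun x => by
  rw [hc, bondForceSum, integral_bondMeasure h hℓδ]
  refine intervalIntegral.integral_congr_ae (ae_of_all _ fun ξ hξ => ?_)
  rw [uIoc_of_le hℓδ] at hξ
  have h1 := hS (x, ξ) hξ
  have h2 := hS (x - ξ, ξ) hξ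
  rw [hφ _ h1, hφ _ h2]
  rw [bondStrainL_apply] at h1 h2
  simp only [sub_add_cancel] at h1 h2
  rw [bondForce_eq (hΨ _ h1), bondForce_eq (hΨ _ h2), bondStrainL_apply, bondStrainL_apply]
  simp only [sub_add_cancel]
  ring

end

end Peridynamics

theorem theorem3 (V m k : ℝ → ℝ) (I : Set ℝ) (c₁ c₂ γ₁ γ₂ δ ℓ : ℝ)
    (hV : ProfileAssumptions V I c₁ c₂ γ₁ γ₂) (hmk : ScalingAssumptions m k γ₂ δ)
    (hℓ : 0 < ℓ) (hℓδ : ℓ < δ) :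
    ∃ K₀ : ℝ, 0 < K₀ ∧ ∀ K : ℝ, K₀ < K →
      ∃ (q : ℝ → ℝ) (μ c : ℝ),
        ContDiff ℝ 2 q ∧
        q ∈ admissible (micropotential (symmetrized V I) m k) ℓ δ K ∧
        IsMinOn kineticEnergy (admissible (micropotential (symmetrized V I) m k) ℓ δ K) q ∧
        (I = Set.Ici 0 → Monotone q) ∧ (I = Set.Iic 0 → Antitone q) ∧
        IsLagrangeMultiplier kineticEnergy
          (potentialEnergy (micropotential (symmetrized V I) m k) ℓ δ) energySpace q μ ∧
        0 < μ ∧ 0 < c ∧ c ^ 2 = μ⁻¹ ∧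
        SolvesTravellingWave (bondForce (micropotential (symmetrized V I) m k)) ℓ δ c q ∧
        SolvesTravellingWave (bondForce (micropotential V m k)) ℓ δ c q := by
  obtain ⟨σ, hσ, hσ1, hσ2⟩ := hV.exists_orientation
  have hΦ := hV.superquadraticProfile hσ
  have hB := isStrainOperator_bondStrainL (δ := δ) hmk hℓ
  set Φ := symmetrized V I
  set φ := evenDeriv fun x => V (σ * x)
  obtain ⟨K₀, hK₀, hmin⟩ := exists_monotone_minimizer hmk hℓ hΦ hℓδ
  refine ⟨K₀, hK₀, fun K hK => ?_⟩
  have hK0 : 0 < K := hK₀.trans hK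
  obtain ⟨u₀, hmono, hu₀K, hu₀⟩ := hmin K hK
  obtain ⟨u, hinc, huK, hu⟩ : ∃ u : L2R, Monotone (fun x => σ * prim u x) ∧
      bondEnergy Φ m k ℓ δ u = K ∧ ∀ v, K ≤ bondEnergy Φ m k ℓ δ v → ‖u‖ ^ 2 ≤ ‖v‖ ^ 2 := by
    refine ⟨σ • u₀, ?_, ?_, ?_⟩
    · convert hmono using 2 with x
      rw [prim_smul, Pi.smul_apply, smul_eq_mul, ← mul_assoc, hσ.sq, one_mul]
    · rcases mul_self_eq_one_iff.mp hσ.sq with rfl | rfl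
      · rwa [one_smul]
      · rwa [neg_one_smul, bondEnergy_neg hΦ]
    · rwa [norm_smul, Real.norm_eq_abs, hσ.abs_eq_one, one_mul]
  set D := strainEnergyDeriv φ ((volume : Measure ℝ).prod (bondMeasure k ℓ δ)) (bondStrainL m) u
  have hDu : 0 < D u := by
    have h1 : 2 * bondEnergy Φ m k ℓ δ u ≤ D u := two_mul_strainEnergy_le hΦ hB u
    linarith
  have hu0 : 0 < ‖u‖ ^ 2 := by
    have : u ≠ 0 := by
      rintro rfl
      have h0 : bondEnergy Φ m k ℓ δ 0 = 0 := strainEnergy_zero hΦ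
      linarith
    positivity
  set μ := ‖u‖ ^ 2 / D u with hμdef
  have hμ : 0 < μ := div_pos hu0 hDu
  have hinner : ∀ v, inner ℝ u v = μ * D v :=
    inner_eq_of_isMin (E := bondEnergy Φ m k ℓ δ) (fun v hv => hu v (huK ▸ hv))
      (hasDerivAt_strainEnergy hΦ hB u) (strainEnergyDeriv_add hΦ hB u)
      (fun v c => strainEnergyDeriv_smul u v c) hDu
  obtain ⟨hC2, hode⟩ := contDiff_two_prim (isWeakDeriv_of_inner_eq hmk hℓ hΦ hinner)
    (continuous_const.mul (continuous_bondForceSum hmk hℓ hΦ u))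
  have hc2 : √μ⁻¹ ^ 2 = μ⁻¹ := Real.sq_sqrt (by positivity)
  have hwave : ∀ x, √μ⁻¹ ^ 2 * iteratedDeriv 2 (prim u) x = bondForceSum φ m k ℓ δ u x :=
    fun x => by rw [hc2, hode, inv_mul_cancel_left₀ hμ.ne']
  refine ⟨prim u, μ, √μ⁻¹, hC2, ⟨prim_mem_energySpace u,
    integrable_energyDensity_prim hmk hℓ hΦ hℓδ.le u,
    (potentialEnergy_prim hmk hℓ hΦ hℓδ.le u).trans huK⟩, ?_, ?_, ?_, ?_, hμ,
    Real.sqrt_pos.mpr (by positivity), hc2, ?_, ?_⟩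
  · rintro _ ⟨hq, -, hqK⟩
    obtain ⟨v, rfl⟩ := exists_eq_prim hq
    rw [potentialEnergy_prim hmk hℓ hΦ hℓδ.le] at hqK
    have := hu v hqK.ge
    simp only [Set.mem_ofPred_eq, kineticEnergy_prim]
    linarith
  · intro hI
    simpa [hσ1 hI] using hinc
  · intro hI a b hab
    have := hinc hab
    simp only [hσ2 hI] at this
    linarith
  · refine ⟨fun ζ => ∫ p, φ (bondStrain m (prim u) p) * bondStrain m ζ p
      ∂(volume : Measure ℝ).prod (bondMeasure k ℓ δ), ⟨prim u, prim_mem_energySpace u, hDu.ne'⟩,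
      fun ζ hζ => ?_⟩
    obtain ⟨v, rfl⟩ := exists_eq_prim hζ
    refine ⟨?_, ?_⟩
    · have := hasDerivAt_strainEnergy hΦ hB u v
      refine this.congr_of_eventuallyEq (Filter.Eventually.of_forall fun ε => ?_)
      simp only
      rw [← prim_smul, ← prim_add, potentialEnergy_prim hmk hℓ hΦ hℓδ.le]
    · have := hasDerivAt_kineticEnergy u v
      rwa [hinner v] at this
  · exact solvesTravellingWave_prim hmk hℓδ.le (S := Set.univ) (fun x _ => hΦ.hasDerivAt x)
      (fun _ _ => rfl) (fun _ _ => Set.mem_univ _) hwave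
  · refine solvesTravellingWave_prim hmk hℓδ.le (S := I) (ψ := deriv V)
      (fun x _ => (hV.contDiff.differentiable (by simp) x).hasDerivAt)
      (fun x hx => evenDeriv_eq_deriv hV hσ hx) (fun p hp => ?_) hwave
    -- The monotonicity of `prim u` puts all its bond strains into the half line `I`.
    have hp0 := hℓ.trans hp.1
    have h1 := hinc (le_add_of_nonneg_right hp0.le : p.1 ≤ p.1 + p.2)
    rw [hσ.mem_iff, bondStrainL_apply, ← mul_div_assoc]
    refine div_nonneg ?_ (hmk.m_pos hp0).le
    simp only at h1
    linarith
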